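/- Let $n\ge 2$ and $m$ be integers, $\tau,N,Y_{0,l}>0$, $\beta_l\in\mathbb R$, $\alpha_l\ge 0$ with $\sum_{l=1}^m\alpha_l=1$, and $r_{ij}=r_{ji}>0$ for $i\ne j$ $(1\le i,j\le n,\ 1\le l\le m)$. Consider the system of delay differential equations on the simplex $\{p\in[0,1]^n:\sum_i p_i=1\}$ $$\dot p_i(t)=p_i(t)\sum_{j\ne i}p_j(t)\,r_{ij}\,\bigl(U_i(t)-U_j(t)\bigr),\qquad U_i(t)=\sum_{l=1}^m\alpha_l\ln\Bigl(1+\frac{X_l(p_i(t-\tau))}{Y_{0,l}(p_i(t)N)^{\beta_l}}\Bigr),$$ where the allocation rules $X_l$ are real functions, nonnegative on $[0,1]$ and $C^1$ near $\bar p=1/n$. Initial histories are continuous maps from $[-\tau,0]$ to the simplex, with the uniform distance. Put $Y_l=Y_{0,l}(\bar pN)^{\beta_l}$, $U_l'=\bigl(1+X_l(\bar p)/Y_l\bigr)^{-1}$, $$\Phi_1=\bar p^2\sum_{l}\frac{\alpha_lU_l'}{Y_l}X_l'(\bar p),\qquad \Phi_2=\bar p^2\sum_{l}\frac{\alpha_lU_l'}{Y_l}\,\beta_l\,\frac{X_l(\bar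 p)}{\bar p},$$ and assume $\Phi_1\ge 0$ (as is the case if the $X_l$ are nondecreasing). Let $\bar\beta=\sum_l\omega_l\beta_l/\sum_l\omega_l$ with $\omega_l=\alpha_lU_l'X_l(\bar p)/Y_l$ be the weighted average scaling exponent (read as $0$ if all $\omega_l$ vanish), and let $M$ be the matrix with entries $M_{ii}=\sum_{k\ne i}r_{ik}$ and $M_{ij}=-r_{ij}$ for $i\neq j$. Then the equal-size state $(\bar p,\dots,\bar p)$ is an equilibrium, and: 1. If $\Phi_1<\Phi_2$, it is locally asymptotically stable: solutions with histories near it exist for all positive times, remain near it, and converge to it. If $\Phi_1>\Phi_2$, it is unstable: there is $\varepsilon>0$ such that arbitrarily close to it there are histories from which a solution reaches distance at least $\varepsilon$ from it. 2. If $\Phi_1<\Phi_2$, then every root $\lambda\in\mathbb C$ of the characteristic equation $\det\bigl(\lambda I-(\Phi_1e^{-\lambda\tau}-\Phi_2)M\bigr)=0$ is $0$ or has negative real part. 3. If allocations are proportional, $X_l(q)=\gamma_l q$ on $[0,1]$ with $\gamma_l>0$ for all $l$, then the equilibrium is locally asymptotically stable if $\bar\beta>1$ and unstable if $\bar\beta<1$.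 4. If all $X_l$ are concave on $[0,1]$ and $\bar\beta>1$, then the equilibrium is locally asymptotically stable. -/

import Mathlib

open Set Filter Topology

noncomputable section

/-- Parameters of the migration model with `n` cities and `m` resources:
total population `N`, resource scales `Y₀ l` and scaling exponents `β l`, preference weights `α l`,
allocation rules `X l` (a city whose population share is `q` is allocated `X l q` of resource `l`),
closeness `r i j` of distinct cities, and the delay `τ` in the realization of allocations. -/
structure CityModel (n m : ℕ) where
  N : ℝ
  N_pos : 0 < N
  Y₀ : Fin m → ℝ
  Y₀_pos : ∀ l, 0 < Y₀ l
  α : Fin m → ℝ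
  α_nonneg : ∀ l, 0 ≤ α l
  α_sum : ∑ l, α l = 1
  β : Fin m → ℝ
  X : Fin m → ℝ → ℝ
  X_nonneg : ∀ l, ∀ q ∈ Icc (0 : ℝ) 1, 0 ≤ X l q
  r : Fin n → Fin n → ℝ
  r_symm : ∀ i j, r i j = r j i
  r_pos : ∀ i j, i ≠ j → 0 < r i j
  τ : ℝ
  τ_pos : 0 < τ

namespace CityModel

variable {n m : ℕ} (C : CityModel n m)

/-- The need `Y₀ (p N) ^ β` for resource `l` in a city with population share `p`. -/
def need (l : Fin m) (p : ℝ) : ℝ := C.Y₀ l * (p * C.N) ^ C.β l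

/-- Utility of a city with current share `p` and with share `q` one delay ago. -/
def utility (p q : ℝ) : ℝ := ∑ l, C.α l * Real.log (1 + C.X l q / C.need l p)

/-- Right-hand side of the replicator equation, with current shares `p` and delayed shares `q`. -/
def field (p q : Fin n → ℝ) : Fin n → ℝ := fun i =>
  p i * ∑ j ∈ Finset.univ.erase i,
    p j * C.r i j * (C.utility (p i) (q i) - C.utility (p j) (q j))

/-- Initial histories: continuous paths `[-τ, 0] → simplex`. -/
def IsHistory (φ : ℝ → Fin n → ℝ) : Prop :=
  ContinuousOn φ (Icc (-C.τ) 0) ∧ ∀ t ∈ Icc (-C.τ) 0, φ t ∈ stdSimplex ℝ (Fin n)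

/-- `p` solves `p'(t) = field (p t) (p (t - τ))` on `[0, T]` with history `φ`
(one-sided derivatives at the two end points). -/
structure IsSolutionOn (φ : ℝ → Fin n → ℝ) (T : ℝ) (p : ℝ → Fin n → ℝ) : Prop where
  history : ∀ t ∈ Icc (-C.τ) 0, p t = φ t
  continuousOn : ContinuousOn p (Icc (-C.τ) T)
  mem_simplex : ∀ t ∈ Icc (-C.τ) T, p t ∈ stdSimplex ℝ (Fin n)
  deriv_eq : ∀ t ∈ Icc 0 T,
    HasDerivWithinAt p (C.field (p t) (p (t - C.τ))) (Icc 0 T) t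

/-- Solution for all positive times. -/
def IsSolution (φ p : ℝ → Fin n → ℝ) : Prop := ∀ T, 0 ≤ T → C.IsSolutionOn φ T p

/-- The history `φ` is uniformly within `δ` of the state `e`. -/
def HistoryNear (e : Fin n → ℝ) (δ : ℝ) (φ : ℝ → Fin n → ℝ) : Prop :=
  C.IsHistory φ ∧ ∀ t ∈ Icc (-C.τ) 0, dist (φ t) e < δ

/-- `e` is an equilibrium: the constant path `e` is a solution. -/
def IsEquilibrium (e : Fin n → ℝ) : Prop := C.IsSolution (fun _ => e) (fun _ => e)

/-- Lyapunov stability of `e`, including the existence of global solutions nearby. -/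
def IsStable (e : Fin n → ℝ) : Prop :=
  ∀ ε > 0, ∃ δ > 0, ∀ φ, C.HistoryNear e δ φ →
    (∃ p, C.IsSolution φ p) ∧
    ∀ T, 0 ≤ T → ∀ p, C.IsSolutionOn φ T p → ∀ t ∈ Icc 0 T, dist (p t) e < ε

/-- Local asymptotic stability of `e`. -/
def IsAsymptoticallyStable (e : Fin n → ℝ) : Prop :=
  C.IsStable e ∧
  ∃ δ > 0, ∀ φ, C.HistoryNear e δ φ → ∀ p, C.IsSolution φ p → Tendsto p atTop (𝓝 e)

/-- Instability of `e`: solutions that start arbitrarily close to `e` reach a fixed distance. -/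
def IsUnstable (e : Fin n → ℝ) : Prop :=
  ∃ ε > 0, ∀ δ > 0, ∃ φ, C.HistoryNear e δ φ ∧
    ∃ T, 0 ≤ T ∧ ∃ p, C.IsSolutionOn φ T p ∧ ε ≤ dist (p T) e

/-- The common share `1 / n` of cities of equal size. -/
def share (_C : CityModel n m) : ℝ := 1 / n

/-- The state in which all cities have the same size. -/
def equalState : Fin n → ℝ := fun _ => C.share

/-- `α U' / Y` for resource `l` at the equal-size state, where `U' = 1 / (1 + X / Y)` is the
derivative of `x ↦ log (1 + x)` at `x = X / Y`. -/
def margin (l : Fin m) : ℝ :=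
  C.α l * (1 + C.X l C.share / C.need l C.share)⁻¹ / C.need l C.share

def Φ₁ : ℝ := C.share ^ 2 * ∑ l, C.margin l * deriv (C.X l) C.share

def Φ₂ : ℝ := C.share ^ 2 * ∑ l, C.margin l * (C.β l * (C.X l C.share / C.share))

/-- The average of the exponents `β l` with weights proportional to `α U' X / Y`. -/
def averageExponent : ℝ :=
  (∑ l, C.margin l * C.X l C.share * C.β l) / ∑ l, C.margin l * C.X l C.share

/-- The weighted Laplacian matrix of the closeness parameters. -/
def lapMatrix : Matrix (Fin n) (Fin n) ℝ := Matrix.of fun i j =>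
  if i = j then ∑ k ∈ Finset.univ.erase i, C.r i k else -C.r i j

/-- Characteristic function `det (z I - (Φ₁ exp (-z τ) - Φ₂) M)` of the linearization at the
equal-size state. -/
def charFun (z : ℂ) : ℂ :=
  (z • (1 : Matrix (Fin n) (Fin n) ℂ) -
    ((C.Φ₁ : ℂ) * Complex.exp (-(z * (C.τ : ℂ))) - (C.Φ₂ : ℂ)) •
      C.lapMatrix.map (fun x : ℝ => (x : ℂ))).det

end CityModel

end

/-!
The deviations `x = p - e` and `y = p (t - τ) - e` of the present and the delayed state from the
equal-size state `e` have mean zero, and the vector field is `M (Φ₁ y - Φ₂ x)` up to a remainder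
that is small relative to `(x, y)`, where `M` is the weighted Laplacian of the closeness parameters
(`exists_remainder_bound`). An orthonormal basis of eigenvectors of `M` decouples the linear part
into scalar delay equations `u' = μ (Φ₁ u(t - τ) - Φ₂ u)`, one for each eigenvalue `μ ≥ 0` of `M`;
the modes with `μ = 0` are constant vectors and hence absent from `x`. Since the allocation rules
are only `C¹`, the remainder is merely `o(‖x‖ + ‖y‖)`, so both conclusions rest on strict
differential inequalities for quadratic functionals of the scalar equations, which absorb it.

Stability: if `0 ≤ Φ₁ < Φ₂`, each scalar equation has the form `w' = -B w + A w(t - τ)` with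
`0 ≤ A < B`, and `dampedFunctional`, which adds to `w ^ 2 / 2` weighted integrals of `w ^ 2` over
the delay interval, decays exponentially. The sum over all modes decays exponentially along every
solution as long as it stays near `e` (`exists_decay`), so a solution that starts near enough to `e`
never leaves. Solutions exist because clamping the states to a small cube makes the right-hand side
bounded and Lipschitz (`exists_delay_solution`, `exists_local_solution`).

Instability: if `Φ₁ > Φ₂`, the modes of the largest eigenvalue `μ` have the growing solution
`exp (r t)`, where `r > 0` and `r = μ (Φ₁ exp (-r τ) - Φ₂)`. After multiplication by `exp (-r t)`,
these top modes satisfy a resonant equation `w' = -A w + A w(t - τ)`, with first integral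
`w + A ∫ w` over the delay interval, while all other modes satisfy a damped equation. The functional
`resonantFunctional` is a large multiple of the square of the first integral minus a Lyapunov
functional; together with `-dampedFunctional` for the other modes it gives a functional `V` with
`V' ≥ -2 σ V` for a rate `σ > 0` that may be taken as small as desired, in particular at most
`r / 2`. If `V` is positive at time `0`, it decays no faster than `exp (-r t)`, whereas a bounded
solution would force it to be `O (exp (-2 r t))`; hence the solution leaves a fixed neighbourhood of
`e` (`exists_escape`). This needs no simplicity of the largest eigenvalue.

The characteristic function factors over the eigenvalues of `M`. For proportional or concave
allocation rules, `Φ₁` is equal to, or at most, the share times the total weight in the average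
exponent, so that comparing `Φ₁` with `Φ₂` amounts to comparing the average exponent with `1`.
-/

/-! ### Integrals over a sliding window -/

/-- The integral of `w` over the window `[t - τ, t]`. -/
noncomputable def windowIntegral (τ : ℝ) (w : ℝ → ℝ) (t : ℝ) : ℝ := ∫ s in (t - τ)..t, w s

/-- The integral of `w` over the window `[t - τ, t]`, with a weight that grows linearly from `0` at
the far end to `τ` at the present. -/
noncomputable def rampIntegral (τ : ℝ) (w : ℝ → ℝ) (t : ℝ) : ℝ :=
  ∫ s in (t - τ)..t, (s - (t - τ)) * w s

section Window

variable {τ : ℝ} {w : ℝ → ℝ} {t : ℝ}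

lemma hasDerivAt_windowIntegral (hw : Continuous w) :
    HasDerivAt (windowIntegral τ w) (w t - w (t - τ)) t := by
  have h0 : ∀ a, HasDerivAt (fun u => ∫ s in (0 : ℝ)..u, w s) (w a) a := fun a =>
    intervalIntegral.integral_hasDerivAt_right (hw.intervalIntegrable _ _)
      (hw.stronglyMeasurableAtFilter _ _) hw.continuousAt
  have h1 : HasDerivAt (fun u => ∫ s in (0 : ℝ)..(u - τ), w s) (w (t - τ)) t := by
    simpa using (h0 (t - τ)).comp_sub_const t τ
  have := (h0 t).sub h1
  refine this.congr_of_eventuallyEq (Eventually.of_forall fun u => ?_)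
  simp only [windowIntegral, Pi.sub_apply]
  rw [intervalIntegral.integral_interval_sub_left (hw.intervalIntegrable _ _)
    (hw.intervalIntegrable _ _)]

lemma rampIntegral_eq (hw : Continuous w) (t : ℝ) :
    rampIntegral τ w t =
      windowIntegral τ (fun s => s * w s) t - (t - τ) * windowIntegral τ w t := by
  unfold rampIntegral windowIntegral
  rw [← intervalIntegral.integral_const_mul, ← intervalIntegral.integral_sub]
  · simp only [sub_mul]
  · exact (by fun_prop : Continuous fun s => s * w s).intervalIntegrable _ _
  · exact (by fun_prop : Continuous fun s => (t - τ) * w s).intervalIntegrable _ _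

lemma hasDerivAt_rampIntegral (hw : Continuous w) :
    HasDerivAt (rampIntegral τ w) (τ * w t - windowIntegral τ w t) t := by
  have h1 := hasDerivAt_windowIntegral (τ := τ) (t := t) (by fun_prop : Continuous fun s => s * w s)
  have h2 := ((hasDerivAt_id t).sub_const τ).mul (hasDerivAt_windowIntegral (τ := τ) (t := t) hw)
  have h3 := h1.sub h2
  rw [show rampIntegral τ w = fun t => windowIntegral τ (fun s => s * w s) t -
    (t - τ) * windowIntegral τ w t from funext fun t => rampIntegral_eq hw t]
  refine h3.congr_deriv ?_
  simp only [id]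
  ring

/-- Cauchy–Schwarz inequality for interval integrals of continuous functions. -/
lemma sq_integral_mul_le {f g : ℝ → ℝ} (hf : Continuous f) (hg : Continuous g) {a b : ℝ}
    (hab : a ≤ b) :
    (∫ s in a..b, f s * g s) ^ 2 ≤ (∫ s in a..b, f s ^ 2) * ∫ s in a..b, g s ^ 2 := by
  have key : ∀ c : ℝ, 0 ≤ (∫ s in a..b, g s ^ 2) * (c * c) +
      (-2 * ∫ s in a..b, f s * g s) * c + ∫ s in a..b, f s ^ 2 := by
    intro c
    have h : 0 ≤ ∫ s in a..b, (f s - c * g s) ^ 2 :=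
      intervalIntegral.integral_nonneg hab fun _ _ => sq_nonneg _
    have h2 : ∫ s in a..b, (f s - c * g s) ^ 2 = (∫ s in a..b, g s ^ 2) * (c * c) +
        (-2 * ∫ s in a..b, f s * g s) * c + ∫ s in a..b, f s ^ 2 := by
      rw [← intervalIntegral.integral_const_mul, ← intervalIntegral.integral_mul_const,
        ← intervalIntegral.integral_mul_const, ← intervalIntegral.integral_add,
        ← intervalIntegral.integral_add]
      · refine intervalIntegral.integral_congr fun s _ => ?_
        ring
      all_goals exact Continuous.intervalIntegrable (by fun_prop) _ _
    rwa [h2] at h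
  have := discrim_le_zero key
  rw [discrim] at this
  nlinarith [this]

/-- The integral over the window of the squared deviation from the present value. -/
lemma windowIntegral_sq_sub (hw : Continuous w) (t : ℝ) :
    ∫ s in (t - τ)..t, (w s - w t) ^ 2 = windowIntegral τ (fun s => w s ^ 2) t
      - 2 * w t * windowIntegral τ w t + τ * w t ^ 2 := by
  have h : ∀ c : ℝ, ∫ s in (t - τ)..t, (w s - c) ^ 2 = windowIntegral τ (fun s => w s ^ 2) t
      - 2 * c * windowIntegral τ w t + τ * c ^ 2 := by
    intro c
    unfold windowIntegral
    have : τ * c ^ 2 = ∫ s in (t - τ)..t, c ^ 2 := by simp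
    rw [this, ← intervalIntegral.integral_const_mul, ← intervalIntegral.integral_sub,
      ← intervalIntegral.integral_add]
    · refine intervalIntegral.integral_congr fun s _ => ?_
      ring
    all_goals exact Continuous.intervalIntegrable (by fun_prop) _ _
  exact h _

lemma integral_ramp (t : ℝ) : ∫ s in (t - τ)..t, (s - (t - τ)) = τ ^ 2 / 2 := by
  rw [intervalIntegral.integral_sub (by simp) (by simp), integral_id]
  simp
  ring

lemma rampIntegral_sq_sub (hw : Continuous w) (t : ℝ) :
    ∫ s in (t - τ)..t, (s - (t - τ)) * (w s - w t) ^ 2 = rampIntegral τ (fun s => w s ^ 2) t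
      - 2 * w t * rampIntegral τ w t + τ ^ 2 / 2 * w t ^ 2 := by
  have h : ∀ c : ℝ, ∫ s in (t - τ)..t, (s - (t - τ)) * (w s - c) ^ 2 =
      rampIntegral τ (fun s => w s ^ 2) t - 2 * c * rampIntegral τ w t + τ ^ 2 / 2 * c ^ 2 := by
    intro c
    unfold rampIntegral
    rw [← integral_ramp (τ := τ) t, ← intervalIntegral.integral_const_mul,
      ← intervalIntegral.integral_mul_const, ← intervalIntegral.integral_sub,
      ← intervalIntegral.integral_add]
    · refine intervalIntegral.integral_congr fun s _ => ?_
      ring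
    all_goals exact Continuous.intervalIntegrable (by fun_prop) _ _
  exact h _

/-- The deviations of the window integrals of `w` from their values for a constant function are
controlled by the integral `D` of the squared deviation of `w` from its present value. -/
lemma window_deviation_bounds (hτ : 0 ≤ τ) (hw : Continuous w) (t : ℝ) {D J : ℝ}
    (hD : D = windowIntegral τ (fun s => w s ^ 2) t - 2 * w t * windowIntegral τ w t + τ * w t ^ 2)
    (hJ : J = rampIntegral τ (fun s => w s ^ 2) t - 2 * w t * rampIntegral τ w t
      + τ ^ 2 / 2 * w t ^ 2) :
    0 ≤ D ∧ 0 ≤ J ∧ J ≤ τ * D ∧ (windowIntegral τ w t - τ * w t) ^ 2 ≤ τ * D ∧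
      (rampIntegral τ w t - τ ^ 2 / 2 * w t) ^ 2 ≤ τ ^ 3 * D := by
  have hle : t - τ ≤ t := by linarith
  rw [← windowIntegral_sq_sub hw] at hD
  rw [← rampIntegral_sq_sub hw] at hJ
  have hD0 : 0 ≤ D := hD ▸ intervalIntegral.integral_nonneg hle fun _ _ => sq_nonneg _
  refine ⟨hD0, ?_, ?_, ?_, ?_⟩
  · rw [hJ]
    exact intervalIntegral.integral_nonneg hle fun s hs =>
      mul_nonneg (by linarith [hs.1]) (sq_nonneg _)
  · rw [hJ, hD, ← intervalIntegral.integral_const_mul]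
    refine intervalIntegral.integral_mono_on hle ?_ ?_ fun s hs =>
      mul_le_mul_of_nonneg_right (by linarith [hs.2]) (sq_nonneg _)
    all_goals exact Continuous.intervalIntegrable (by fun_prop) _ _
  · have h := sq_integral_mul_le (f := fun s => w s - w t) (g := fun _ => 1) (by fun_prop)
      (by fun_prop) hle
    have e : ∫ s in (t - τ)..t, (w s - w t) * 1 = windowIntegral τ w t - τ * w t := by
      unfold windowIntegral
      rw [show τ * w t = ∫ s in (t - τ)..t, w t by simp, ← intervalIntegral.integral_sub]
      · simp
      all_goals exact Continuous.intervalIntegrable (by fun_prop) _ _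
    rw [e, ← hD] at h
    simpa [mul_comm] using h
  · have h := sq_integral_mul_le (f := fun s => w s - w t) (g := fun s => s - (t - τ)) (by fun_prop)
      (by fun_prop) hle
    have e : ∫ s in (t - τ)..t, (w s - w t) * (s - (t - τ)) =
        rampIntegral τ w t - τ ^ 2 / 2 * w t := by
      unfold rampIntegral
      rw [← integral_ramp (τ := τ) t, ← intervalIntegral.integral_mul_const,
        ← intervalIntegral.integral_sub]
      · refine intervalIntegral.integral_congr fun s _ => ?_
        ring
      all_goals exact Continuous.intervalIntegrable (by fun_prop) _ _
    rw [e, ← hD] at h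
    have e2 : ∫ s in (t - τ)..t, (s - (t - τ)) ^ 2 ≤ τ ^ 3 := by
      have : ∫ s in (t - τ)..t, (s - (t - τ)) ^ 2 ≤ ∫ s in (t - τ)..t, τ ^ 2 := by
        refine intervalIntegral.integral_mono_on hle ?_ ?_ fun s hs =>
          pow_le_pow_left₀ (by linarith [hs.1]) (by linarith [hs.2]) 2
        all_goals exact Continuous.intervalIntegrable (by fun_prop) _ _
      refine this.trans (le_of_eq ?_)
      simp
      ring
    calc _ ≤ _ := h
      _ ≤ D * τ ^ 3 := mul_le_mul_of_nonneg_left e2 hD0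
      _ = _ := mul_comm _ _

lemma windowIntegral_sq_nonneg (hτ : 0 ≤ τ) : 0 ≤ windowIntegral τ (fun s => w s ^ 2) t :=
  intervalIntegral.integral_nonneg (by linarith) fun _ _ => sq_nonneg _

lemma rampIntegral_sq_nonneg (hτ : 0 ≤ τ) : 0 ≤ rampIntegral τ (fun s => w s ^ 2) t :=
  intervalIntegral.integral_nonneg (by linarith) fun s hs =>
    mul_nonneg (by linarith [hs.1]) (sq_nonneg _)

lemma rampIntegral_sq_le (hτ : 0 ≤ τ) (hw : Continuous w) :
    rampIntegral τ (fun s => w s ^ 2) t ≤ τ * windowIntegral τ (fun s => w s ^ 2) t := by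
  unfold rampIntegral windowIntegral
  rw [← intervalIntegral.integral_const_mul]
  refine intervalIntegral.integral_mono_on (by linarith) ?_ ?_ fun s hs =>
      mul_le_mul_of_nonneg_right (by linarith [hs.2]) (sq_nonneg _)
  all_goals exact Continuous.intervalIntegrable (by fun_prop) _ _

lemma windowIntegral_sq_le (hτ : 0 ≤ τ) (hw : Continuous w) {S : ℝ}
    (hS : ∀ s ∈ Icc (t - τ) t, |w s| ≤ S) :
    windowIntegral τ (fun s => w s ^ 2) t ≤ τ * S ^ 2 := by
  unfold windowIntegral
  have : ∫ s in (t - τ)..t, w s ^ 2 ≤ ∫ s in (t - τ)..t, S ^ 2 := by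
    refine intervalIntegral.integral_mono_on (by linarith) ?_ ?_ fun s hs => ?_
    · exact Continuous.intervalIntegrable (by fun_prop) _ _
    · exact Continuous.intervalIntegrable (by fun_prop) _ _
    · exact sq_le_sq' (by linarith [abs_le.1 (hS s hs)]) (abs_le.1 (hS s hs)).2
  refine this.trans (le_of_eq ?_)
  simp

lemma abs_windowIntegral_le (hτ : 0 ≤ τ) {S : ℝ} (hS : ∀ s ∈ Icc (t - τ) t, |w s| ≤ S) :
    |windowIntegral τ w t| ≤ τ * S := by
  have := intervalIntegral.norm_integral_le_of_norm_le_const (a := t - τ) (b := t) (f := w) (C := S)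
    (fun s hs => hS s (by rw [uIoc_of_le (by linarith)] at hs; exact ⟨hs.1.le, hs.2⟩))
  rw [Real.norm_eq_abs, sub_sub_cancel, abs_of_nonneg hτ] at this
  simpa [windowIntegral, mul_comm] using this

end Window

/-! ### Quadratic functionals for the scalar equation `w' = -B w + A w(t - τ) + R` -/

/-- The quadratic functional that decays along `w' = -B w + A w(t - τ)` when `0 ≤ A < B`. -/
noncomputable def dampedFunctional (τ A κ : ℝ) (w : ℝ → ℝ) (t : ℝ) : ℝ :=
  w t ^ 2 / 2 + (A / 2 + κ) * windowIntegral τ (fun s => w s ^ 2) t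
    + κ * rampIntegral τ (fun s => w s ^ 2) t

/-- The indefinite quadratic functional for `w' = -A w + A w(t - τ)`, an equation whose linear
first integral is `w t + A * windowIntegral τ w t`. The term with `ε` is the ramp integral of
`(w s - w t) ^ 2`. -/
noncomputable def resonantFunctional (τ A K ε κ : ℝ) (w : ℝ → ℝ) (t : ℝ) : ℝ :=
  K * (w t + A * windowIntegral τ w t) ^ 2 - w t ^ 2 / 2
    - (A / 2 + κ) * windowIntegral τ (fun s => w s ^ 2) t
    - ε * (rampIntegral τ (fun s => w s ^ 2) t - 2 * w t * rampIntegral τ w t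
      + τ ^ 2 / 2 * w t ^ 2)

section Functionals

variable {τ : ℝ}

lemma half_sq_le_dampedFunctional {A κ : ℝ} (hτ : 0 ≤ τ) (hA : 0 ≤ A) (hκ : 0 ≤ κ) (w : ℝ → ℝ)
    (t : ℝ) : w t ^ 2 / 2 ≤ dampedFunctional τ A κ w t := by
  have h1 := windowIntegral_sq_nonneg (w := w) (t := t) hτ
  have h2 := rampIntegral_sq_nonneg (w := w) (t := t) hτ
  unfold dampedFunctional
  have h3 : 0 ≤ (A / 2 + κ) * windowIntegral τ (fun s => w s ^ 2) t := by positivity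
  have h4 : 0 ≤ κ * rampIntegral τ (fun s => w s ^ 2) t := by positivity
  linarith

lemma dampedFunctional_le {A κ : ℝ} (hτ : 0 ≤ τ) (hA : 0 ≤ A) (hκ : 0 ≤ κ) {w : ℝ → ℝ}
    (hw : Continuous w) {t S : ℝ} (hS : ∀ s ∈ Icc (t - τ) t, |w s| ≤ S) :
    dampedFunctional τ A κ w t ≤ (1 / 2 + (A / 2 + κ) * τ + κ * τ ^ 2) * S ^ 2 := by
  have h1 := windowIntegral_sq_le hτ hw hS
  have h2 := (rampIntegral_sq_le (t := t) hτ hw).trans (mul_le_mul_of_nonneg_left h1 hτ)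
  have h3 : w t ^ 2 ≤ S ^ 2 := by
    have := abs_le.1 (hS t ⟨by linarith, le_rfl⟩)
    exact sq_le_sq' (by linarith) this.2
  have h4 := mul_le_mul_of_nonneg_left h1 (by positivity : 0 ≤ A / 2 + κ)
  have h5 := mul_le_mul_of_nonneg_left h2 hκ
  unfold dampedFunctional
  nlinarith

/-- Decay of the damped functional with rate `2 σ`, up to the perturbation `R`; the constants depend
only on a lower bound `g` for `B - A` and an upper bound `A'` for `A`. -/
lemma hasDerivWithinAt_dampedFunctional (hτ : 0 < τ) {g A' : ℝ} (hg : 0 < g) (hA' : 0 ≤ A') :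
    ∃ κ > 0, ∃ σ₀ > 0, ∀ σ, 0 < σ → σ ≤ σ₀ → ∀ A B, 0 ≤ A → A ≤ A' → g ≤ B - A →
      ∀ (w : ℝ → ℝ) (s : Set ℝ) (t R : ℝ), Continuous w →
        HasDerivWithinAt w (-B * w t + A * w (t - τ) + R) s t →
        ∃ N', HasDerivWithinAt (dampedFunctional τ A κ w) N' s t ∧
          N' ≤ -(2 * σ) * dampedFunctional τ A κ w t - κ * (w t ^ 2 + w (t - τ) ^ 2)
            + g⁻¹ * R ^ 2 := by
  set κ := g / (4 * (1 + τ)) with hκdef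
  have hκ : 0 < κ := by positivity
  have hκg : κ * (1 + τ) = g / 4 := by rw [hκdef]; field_simp
  refine ⟨κ, hκ, min (g / 4) (κ / (A' + 2 * κ * (1 + τ))), by positivity, ?_⟩
  intro σ hσ hσ0 A B hA hAA' hgB w s t R hw hder
  have hσ1 : σ ≤ g / 4 := hσ0.trans (min_le_left _ _)
  have hσ2 : σ * (A' + 2 * κ * (1 + τ)) ≤ κ := by
    rw [← le_div_iff₀ (by positivity)]
    exact hσ0.trans (min_le_right _ _)
  have hw2 : Continuous fun s => w s ^ 2 := by fun_prop
  have d1 := (hasDerivAt_windowIntegral (τ := τ) (t := t) hw2).hasDerivWithinAt (s := s)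
  have d2 := (hasDerivAt_rampIntegral (τ := τ) (t := t) hw2).hasDerivWithinAt (s := s)
  refine ⟨_, (((hder.pow 2).div_const 2).add (d1.const_mul (A / 2 + κ))).add (d2.const_mul κ), ?_⟩
  have hI := windowIntegral_sq_nonneg (w := w) (t := t) hτ.le
  have hH := rampIntegral_sq_le (t := t) hτ.le hw
  unfold dampedFunctional
  set I := windowIntegral τ (fun s => w s ^ 2) t
  set H := rampIntegral τ (fun s => w s ^ 2) t
  set x := w t
  set y := w (t - τ)
  have e1 : A * x * y ≤ A / 2 * (x ^ 2 + y ^ 2) := by nlinarith [mul_nonneg hA (sq_nonneg (x - y))]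
  have e2 : x * R ≤ g / 4 * x ^ 2 + g⁻¹ * R ^ 2 := by
    have : 0 ≤ g⁻¹ * (g / 2 * x - R) ^ 2 := by positivity
    have h : g⁻¹ * (g / 2 * x - R) ^ 2 = g / 4 * x ^ 2 + g⁻¹ * R ^ 2 - x * R := by
      field_simp; ring
    linarith
  have e3 : g * x ^ 2 ≤ (B - A) * x ^ 2 := mul_le_mul_of_nonneg_right hgB (sq_nonneg x)
  have e4 : κ * (1 + τ) * x ^ 2 = g / 4 * x ^ 2 := by rw [hκg]
  have e5 : σ * (A' + 2 * κ * (1 + τ)) * I ≤ κ * I := mul_le_mul_of_nonneg_right hσ2 hI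
  have e6 : σ * κ * H ≤ σ * κ * (τ * I) := mul_le_mul_of_nonneg_left hH (by positivity)
  have e7 : σ * A * I ≤ σ * A' * I := by gcongr
  have e8 : σ * x ^ 2 ≤ g / 4 * x ^ 2 := by gcongr
  have e9 : 0 ≤ κ * τ * x ^ 2 := by positivity
  simp only [Nat.cast_ofNat, Nat.add_one_sub_one, pow_one]
  nlinarith

set_option maxHeartbeats 1000000 in
/-- Up to the perturbation `R`, a positive value of the resonant functional `V` decreases at most at
the small rate `2 σ`. Where the first integral
`w t + A * windowIntegral τ w t` vanishes, `-V` is a Lyapunov functional. -/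
lemma hasDerivWithinAt_resonantFunctional (hτ : 0 < τ) {A : ℝ} (hA : 0 ≤ A) :
    ∃ K, 1 + (A / 2 + 1) * τ ≤ K ∧ ∃ ε > 0, ∃ σ₀ > 0, ∀ σ, 0 < σ → σ ≤ σ₀ → σ ≤ 1 ∧
      ∃ C, 0 ≤ C ∧ ∀ (w : ℝ → ℝ) (s : Set ℝ) (t R : ℝ), Continuous w →
        HasDerivWithinAt w (-A * w t + A * w (t - τ) + R) s t →
        ∃ V', HasDerivWithinAt (resonantFunctional τ A K ε σ w) V' s t ∧
          -(2 * σ) * resonantFunctional τ A K ε σ w t + σ * (w t ^ 2 + w (t - τ) ^ 2)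
            - C * R ^ 2 ≤ V' := by
  -- `ε` is small enough to absorb the derivative of the present value in the ramp term, and `K`
  -- large enough for the first integral to control the present value
  set ε := 1 / (8 * (1 + A) * (1 + τ ^ 3)) with hε
  set θ := 3 + 2 * τ * (A + 2) with hθ
  set K := 2 * (θ + 1) with hK
  set E := 2 * (A + 2) + 2 * ε * τ + (θ + 1) * 2 * A ^ 2 * τ with hE
  have hε0 : 0 < ε := by positivity
  have hθ0 : 0 < θ := by positivity
  have hE0 : 0 < E := by positivity
  have hεA : ε * (A * τ ^ 3) ≤ 1 / 8 := by
    rw [hε, div_mul_eq_mul_div, div_le_div_iff₀ (by positivity) (by positivity)]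
    have : 0 ≤ A * τ ^ 3 := by positivity
    have : 0 ≤ τ ^ 3 := by positivity
    nlinarith
  refine ⟨K, ?_, ε, hε0, min 1 (5 * ε / 8 / E), by positivity, ?_⟩
  · rw [hK, hθ]
    have : 0 ≤ τ * A := by positivity
    nlinarith
  intro σ hσ hσ0
  have hσ1 : σ ≤ 1 := hσ0.trans (min_le_left _ _)
  have hσ2 : σ * E ≤ 5 * ε / 8 := by
    rw [← le_div_iff₀ hE0]
    exact hσ0.trans (min_le_right _ _)
  refine ⟨hσ1, K / σ + 1 / (4 * σ) + 8 * ε * τ ^ 3, by positivity, ?_⟩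
  intro w s t R hw hder
  have hw2 : Continuous fun s => w s ^ 2 := by fun_prop
  have d0 := (hasDerivAt_windowIntegral (τ := τ) (t := t) hw).hasDerivWithinAt (s := s)
  have d1 := (hasDerivAt_windowIntegral (τ := τ) (t := t) hw2).hasDerivWithinAt (s := s)
  have d2 := (hasDerivAt_rampIntegral (τ := τ) (t := t) hw).hasDerivWithinAt (s := s)
  have d3 := (hasDerivAt_rampIntegral (τ := τ) (t := t) hw2).hasDerivWithinAt (s := s)
  refine ⟨_, (((((hder.add (d0.const_mul A)).pow 2).const_mul K).sub
    ((hder.pow 2).div_const 2)).sub (d1.const_mul (A / 2 + σ))).sub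
    (((d3.sub ((hder.const_mul 2).mul d2)).add
      ((hder.pow 2).const_mul (τ ^ 2 / 2))).const_mul ε), ?_⟩
  obtain ⟨hD, -, hJ, hm, hh⟩ := window_deviation_bounds hτ.le hw t rfl rfl
  unfold resonantFunctional
  simp only [Nat.cast_ofNat, Nat.add_one_sub_one, pow_one, Pi.add_apply]
  set I := windowIntegral τ w t
  set I2 := windowIntegral τ (fun s => w s ^ 2) t
  set H := rampIntegral τ w t
  set H2 := rampIntegral τ (fun s => w s ^ 2) t
  set x := w t
  set y := w (t - τ)
  obtain ⟨D, hDdef⟩ : ∃ D, D = I2 - 2 * x * I + τ * x ^ 2 := ⟨_, rfl⟩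
  obtain ⟨J, hJdef⟩ : ∃ J, J = H2 - 2 * x * H + τ ^ 2 / 2 * x ^ 2 := ⟨_, rfl⟩
  obtain ⟨h, hhdef⟩ : ∃ h, h = H - τ ^ 2 / 2 * x := ⟨_, rfl⟩
  obtain ⟨m, hmdef⟩ : ∃ m, m = I - τ * x := ⟨_, rfl⟩
  obtain ⟨l, hldef⟩ : ∃ l, l = x + A * I := ⟨_, rfl⟩
  obtain ⟨d, hddef⟩ : ∃ d, d = x - y := ⟨_, rfl⟩
  rw [← hDdef, ← hJdef] at hJ
  rw [← hDdef] at hD hm hh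
  rw [← hmdef] at hm
  rw [← hhdef] at hh
  have goal_eq : K * (2 * (x + A * I) * (-A * x + A * y + R + A * (x - y)))
      - 2 * x * (-A * x + A * y + R) / 2 - (A / 2 + σ) * (x ^ 2 - y ^ 2)
      - ε * (τ * x ^ 2 - I2 - (2 * (-A * x + A * y + R) * H + 2 * x * (τ * x - I))
        + τ ^ 2 / 2 * (2 * x * (-A * x + A * y + R)))
      = 2 * K * (l * R) + A / 2 * d ^ 2 - x * R - σ * (x ^ 2 - y ^ 2) + ε * D
        + 2 * ε * ((-A * d + R) * h) := by
    rw [hldef, hddef, hDdef, hhdef]; ring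
  have hI2 : I2 ≤ 2 * D + 2 * τ * x ^ 2 := by
    have : I2 = D + 2 * x * m + τ * x ^ 2 := by rw [hDdef, hmdef]; ring
    have h2 : 2 * x * m ≤ τ * x ^ 2 + D := by
      have h3 : 0 ≤ τ⁻¹ * (τ * x - m) ^ 2 := by positivity
      have h4 : τ⁻¹ * (τ * x - m) ^ 2 = τ * x ^ 2 - 2 * x * m + τ⁻¹ * m ^ 2 := by
        field_simp; ring
      have h5 : τ⁻¹ * m ^ 2 ≤ τ⁻¹ * (τ * D) := by gcongr
      rw [inv_mul_cancel_left₀ hτ.ne'] at h5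
      linarith
    linarith
  have hx : x ^ 2 ≤ 2 * l ^ 2 + 2 * A ^ 2 * (τ * D) := by
    have h1 : (1 + A * τ) * x = l - A * m := by rw [hldef, hmdef]; ring
    have h2 : x ^ 2 ≤ ((1 + A * τ) * x) ^ 2 := by
      rw [mul_pow]
      have : (1 : ℝ) ≤ (1 + A * τ) ^ 2 := one_le_pow₀ (by nlinarith [mul_nonneg hA hτ.le])
      nlinarith [sq_nonneg x]
    have h3 : A ^ 2 * m ^ 2 ≤ A ^ 2 * (τ * D) := by gcongr
    rw [h1] at h2
    linarith [sq_nonneg (l + A * m)]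
  have t1 : -(A / 2 * d ^ 2) - ε / 4 * D ≤ 2 * ε * (-A * d * h) := by
    have h1 : 0 ≤ A / 2 * (d - 2 * ε * h) ^ 2 := by positivity
    have h2 : 2 * ε * (ε * A * h ^ 2) ≤ 2 * ε * (ε * A * (τ ^ 3 * D)) := by gcongr
    have h3 : 2 * ε * D * (ε * (A * τ ^ 3)) ≤ 2 * ε * D * (1 / 8) := by gcongr
    linarith
  have t2 : -(ε / 8 * D) - 8 * ε * τ ^ 3 * R ^ 2 ≤ 2 * ε * (R * h) := by
    have h1 : 0 ≤ ε * (1 / (8 * τ ^ 3)) * (8 * τ ^ 3 * R + h) ^ 2 := by positivity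
    have h2 : ε * (1 / (8 * τ ^ 3)) * (8 * τ ^ 3 * R + h) ^ 2 =
      8 * ε * τ ^ 3 * R ^ 2 + 2 * ε * (R * h) + ε / 8 * (1 / τ ^ 3 * h ^ 2) := by
      field_simp; ring
    have h3 : ε / 8 * (1 / τ ^ 3 * h ^ 2) ≤ ε / 8 * (1 / τ ^ 3 * (τ ^ 3 * D)) := by gcongr
    rw [← mul_assoc (1 / τ ^ 3), one_div_mul_cancel (by positivity), one_mul] at h3
    linarith
  have t3 : -(σ * x ^ 2) - 1 / (4 * σ) * R ^ 2 ≤ -(x * R) := by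
    have h1 : 0 ≤ 1 / (4 * σ) * (2 * σ * x - R) ^ 2 := by positivity
    have h2 : 1 / (4 * σ) * (2 * σ * x - R) ^ 2 = σ * x ^ 2 - x * R + 1 / (4 * σ) * R ^ 2 := by
      field_simp; ring
    linarith
  have t4 : -(σ * K * l ^ 2) - K / σ * R ^ 2 ≤ 2 * K * (l * R) := by
    have h1 : 0 ≤ K / σ * (σ * l + R) ^ 2 := by positivity
    have h2 : K / σ * (σ * l + R) ^ 2 = σ * K * l ^ 2 + 2 * K * (l * R) + K / σ * R ^ 2 := by
      field_simp; ring
    linarith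
  have t5 : σ * (A + 2 * σ) * I2 ≤ σ * (A + 2) * (2 * D + 2 * τ * x ^ 2) := by
    have : 0 ≤ 2 * D + 2 * τ * x ^ 2 := by positivity
    calc _ ≤ σ * (A + 2 * σ) * (2 * D + 2 * τ * x ^ 2) := by gcongr
      _ ≤ σ * (A + 2) * (2 * D + 2 * τ * x ^ 2) := by gcongr; linarith
  have t6 : 2 * σ * ε * J ≤ 2 * σ * ε * (τ * D) := by gcongr
  have t7 : σ * (θ + 1) * x ^ 2 ≤ σ * (θ + 1) * (2 * l ^ 2 + 2 * A ^ 2 * (τ * D)) := by gcongr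
  have t8 : σ * E * D ≤ 5 * ε / 8 * D := by gcongr
  rw [goal_eq, ← hldef, ← hJdef]
  rw [hE] at t8
  rw [hK] at t4 ⊢
  rw [hθ] at t4 t7 t8 ⊢
  linarith

lemma resonantFunctional_const (A K ε κ c t : ℝ) :
    resonantFunctional τ A K ε κ (fun _ => c) t =
      (K * (1 + A * τ) ^ 2 - 1 / 2 - (A / 2 + κ) * τ) * c ^ 2 := by
  unfold resonantFunctional windowIntegral rampIntegral
  rw [intervalIntegral.integral_mul_const, intervalIntegral.integral_mul_const, integral_ramp]
  simp
  ring

lemma resonantFunctional_le {A K ε κ : ℝ} (hτ : 0 ≤ τ) (hA : 0 ≤ A) (hK : 0 ≤ K) (hε : 0 ≤ ε)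
    (hκ : 0 ≤ κ) {w : ℝ → ℝ} (hw : Continuous w) {t S : ℝ}
    (hS : ∀ s ∈ Icc (t - τ) t, |w s| ≤ S) :
    resonantFunctional τ A K ε κ w t ≤ K * (1 + A * τ) ^ 2 * S ^ 2 := by
  obtain ⟨-, hJ, -, -, -⟩ := window_deviation_bounds hτ hw t rfl rfl
  have hI := windowIntegral_sq_nonneg (w := w) (t := t) hτ
  have h1 := abs_windowIntegral_le hτ hS
  have h2 := hS t ⟨by linarith, le_rfl⟩
  have h3 : |w t + A * windowIntegral τ w t| ≤ (1 + A * τ) * S := by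
    calc _ ≤ |w t| + |A * windowIntegral τ w t| := abs_add_le _ _
      _ = |w t| + A * |windowIntegral τ w t| := by rw [abs_mul, abs_of_nonneg hA]
      _ ≤ S + A * (τ * S) := by gcongr
      _ = _ := by ring
  have h4 : (w t + A * windowIntegral τ w t) ^ 2 ≤ ((1 + A * τ) * S) ^ 2 :=
    sq_le_sq' (by linarith [abs_le.1 h3]) (abs_le.1 h3).2
  have h5 := mul_le_mul_of_nonneg_left h4 hK
  have h6 : 0 ≤ (A / 2 + κ) * windowIntegral τ (fun s => w s ^ 2) t := by positivity
  have h7 := mul_nonneg hε hJ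
  unfold resonantFunctional
  nlinarith [sq_nonneg (w t)]

end Functionals

/-! ### Existence of solutions of delay equations, and facts about differential inequalities -/

section Delay

variable {E : Type*} [NormedAddCommGroup E] [NormedSpace ℝ E]

lemma exists_solution_of_lipschitz_of_bounded [CompleteSpace E] {g : ℝ → E → E} {K L : NNReal}
    (hK : ∀ t, LipschitzWith K (g t)) (hc : ∀ x, Continuous fun t => g t x)
    (hL : ∀ t x, ‖g t x‖ ≤ L) (x₀ : E) {a b : ℝ} (hab : a ≤ b) :
    ∃ α : ℝ → E, α a = x₀ ∧ ∀ t ∈ Icc a b, HasDerivWithinAt α (g t (α t)) (Icc a b) t := by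
  have h : IsPicardLindelof g (tmin := a) (tmax := b) ⟨a, left_mem_Icc.2 hab⟩ x₀
      (L * (b - a).toNNReal) 0 L K :=
    { lipschitzOnWith := fun t _ => (hK t).lipschitzOnWith
      continuousOn := fun x _ => (hc x).continuousOn
      norm_le := fun t _ x _ => hL t x
      mul_max_le := by
        simp [hab] }
  exact h.exists_eq_forall_mem_Icc_hasDerivWithinAt₀

/-- One step of the method of steps: a solution on `[0, a]` extends to `[0, a + τ]`. -/
lemma exists_delay_solution_step [CompleteSpace E] {f : E × E → E} {K L : NNReal}
    (hK : LipschitzWith K f) (hL : ∀ z, ‖f z‖ ≤ L) {τ : ℝ} (hτ : 0 < τ) {a : ℝ} (ha : 0 ≤ a)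
    {p : ℝ → E} (hp : Continuous p)
    (hder : ∀ t ∈ Icc 0 a, HasDerivWithinAt p (f (p t, p (t - τ))) (Icc 0 a) t) :
    ∃ q : ℝ → E, Continuous q ∧ (∀ t ≤ a, q t = p t) ∧
      ∀ t ∈ Icc 0 (a + τ), HasDerivWithinAt q (f (q t, q (t - τ))) (Icc 0 (a + τ)) t := by
  have hab : a ≤ a + τ := by linarith
  obtain ⟨α, hα0, hα⟩ := exists_solution_of_lipschitz_of_bounded
    (g := fun t x => f (x, p (t - τ))) (K := K * 1) (L := L)
    (fun t => hK.comp (by simpa using LipschitzWith.prodMk_right (p (t - τ))))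
    (fun x => by have := hK.continuous; fun_prop) (fun t x => hL _) (p a) hab
  have hαc : Continuous fun t => α (projIcc a (a + τ) hab t) :=
    ContinuousOn.comp_continuous (fun t ht => (hα t ht).continuousWithinAt)
      (continuous_subtype_val.comp continuous_projIcc) fun t => (projIcc a (a + τ) hab t).2
  set q : ℝ → E := fun t => if t ≤ a then p t else α (projIcc a (a + τ) hab t) with hq
  have hq1 : ∀ t ≤ a, q t = p t := fun t ht => if_pos ht
  have hq2 : ∀ t ∈ Icc a (a + τ), q t = α t := by
    intro t ht
    rcases ht.1.eq_or_lt with rfl | h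
    · rw [hq1 _ le_rfl, hα0]
    · simp only [hq]
      rw [if_neg (not_le.2 h), projIcc_of_mem hab ht]
  refine ⟨q, hp.if_le hαc continuous_id continuous_const ?_, hq1, ?_⟩
  · rintro t rfl
    rw [projIcc_left, hα0]
  · intro t ht
    have hdel : q (t - τ) = p (t - τ) := hq1 _ (by linarith [ht.2])
    have e1 : t ≤ a → HasDerivWithinAt q (f (q t, q (t - τ))) (Icc 0 a) t := by
      intro hta
      rw [hdel, hq1 t hta]
      exact (hder t ⟨ht.1, hta⟩).congr (fun s hs => hq1 s hs.2) (hq1 t hta)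
    have e2 : a ≤ t → HasDerivWithinAt q (f (q t, q (t - τ))) (Icc a (a + τ)) t := by
      intro hta
      rw [hdel, hq2 t ⟨hta, ht.2⟩]
      exact (hα t ⟨hta, ht.2⟩).congr (fun s hs => hq2 s hs) (hq2 t ⟨hta, ht.2⟩)
    rcases lt_trichotomy t a with h | h | h
    · refine (e1 h.le).mono_of_mem_nhdsWithin ?_
      filter_upwards [self_mem_nhdsWithin, mem_nhdsWithin_of_mem_nhds (Iio_mem_nhds h)] with s h1 h2
      exact ⟨h1.1, le_of_lt h2⟩
    · have := (e1 h.le).union (e2 h.ge)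
      rwa [Icc_union_Icc_eq_Icc ha hab] at this
    · refine (e2 h.le).mono_of_mem_nhdsWithin ?_
      filter_upwards [self_mem_nhdsWithin, mem_nhdsWithin_of_mem_nhds (Ioi_mem_nhds h)] with s h1 h2
      exact ⟨le_of_lt h2, h1.2⟩

/-- A delay equation with a bounded Lipschitz right-hand side has a global solution for every
continuous history. -/
theorem exists_delay_solution [CompleteSpace E] {f : E × E → E} {K L : NNReal}
    (hK : LipschitzWith K f) (hL : ∀ z, ‖f z‖ ≤ L) {τ : ℝ} (hτ : 0 < τ) {φ : ℝ → E}
    (hφ : Continuous φ) :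
    ∃ p : ℝ → E, (∀ t ≤ 0, p t = φ t) ∧ ∀ T, 0 ≤ T → ContinuousOn p (Iic T) ∧
      ∀ t ∈ Icc 0 T, HasDerivWithinAt p (f (p t, p (t - τ))) (Icc 0 T) t := by
  let S : ℕ → Type _ := fun k => {p : ℝ → E // Continuous p ∧
    ∀ t ∈ Icc 0 (k * τ), HasDerivWithinAt p (f (p t, p (t - τ))) (Icc 0 (k * τ)) t}
  have step : ∀ k (p : S k), ∃ q : S (k + 1), ∀ t ≤ k * τ, q.1 t = p.1 t := by
    rintro k ⟨p, hp, hder⟩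
    obtain ⟨q, h1, h2, h3⟩ := exists_delay_solution_step hK hL hτ (a := k * τ) (by positivity)
      hp hder
    have e : ((k + 1 : ℕ) : ℝ) * τ = k * τ + τ := by push_cast; ring
    exact ⟨⟨q, h1, by rw [e]; exact h3⟩, h2⟩
  choose next hnext using step
  let P : ∀ k, S k := fun k => Nat.rec
    ⟨φ, hφ, by
      intro t ht
      simp only [Nat.cast_zero, zero_mul] at ht ⊢
      exact HasFDerivWithinAt.of_subsingleton (by simp)⟩ (fun k p => next k p) k
  have hP : ∀ (k : ℕ) (t : ℝ), t ≤ k * τ → (P (k + 1)).1 t = (P k).1 t := fun k t ht => hnext k (P k) t ht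
  have hmono : ∀ j k : ℕ, j ≤ k → ∀ t : ℝ, t ≤ j * τ → (P k).1 t = (P j).1 t := by
    intro j k hjk
    induction k, hjk using Nat.le_induction with
    | base => intro t _; rfl
    | succ k hjk ih =>
      intro t ht
      rw [hP k t (ht.trans (by gcongr)), ih t ht]
  have hceil : ∀ t : ℝ, t ≤ ⌈t / τ⌉₊ * τ := fun t => (div_le_iff₀ hτ).1 (Nat.le_ceil _)
  have hp : ∀ (k : ℕ) (t : ℝ), t ≤ k * τ → (P ⌈t / τ⌉₊).1 t = (P k).1 t := fun k t ht =>
    (hmono _ k (Nat.ceil_le.2 ((div_le_iff₀ hτ).2 ht)) t (hceil t)).symm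
  refine ⟨fun t => (P ⌈t / τ⌉₊).1 t, fun t ht => hp 0 t (by simpa using ht), fun T hT => ?_⟩
  set k := ⌈T / τ⌉₊
  have hk : T ≤ k * τ := hceil T
  have heq : ∀ t ≤ T, (P ⌈t / τ⌉₊).1 t = (P k).1 t := fun t ht => hp k t (ht.trans hk)
  refine ⟨(P k).2.1.continuousOn.congr fun t ht => heq t ht, fun t ht => ?_⟩
  beta_reduce
  rw [heq t ht.2, heq (t - τ) (by linarith [ht.2])]
  exact (((P k).2.2 t ⟨ht.1, ht.2.trans hk⟩).mono (Icc_subset_Icc_right hk)).congr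
    (fun s hs => heq s hs.2) (heq t ht.2)

/-- A continuous function that starts below `ε` and later is at least `ε` has a first time at which
it equals `ε`. -/
lemma exists_first_exit {f : ℝ → ℝ} {a b c ε : ℝ} (hab : a ≤ b) (hf : ContinuousOn f (Icc a c))
    (h0 : ∀ t ∈ Icc a b, f t < ε) (hbc : b ≤ c) (hc : ε ≤ f c) :
    ∃ t ∈ Icc b c, f t = ε ∧ ∀ s ∈ Icc a t, f s ≤ ε := by
  have hcomp : IsCompact (Icc a c ∩ f ⁻¹' Ici ε) :=
    isCompact_Icc.of_isClosed_subset (hf.preimage_isClosed_of_isClosed isClosed_Icc isClosed_Ici)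
      inter_subset_left
  obtain ⟨t, ⟨ht, hft⟩, hmin⟩ := hcomp.exists_isLeast ⟨c, ⟨hab.trans hbc, le_rfl⟩, hc⟩
  have hbt : b ≤ t := by
    by_contra! h
    exact absurd (h0 t ⟨ht.1, h.le⟩) (not_lt.2 hft)
  obtain ⟨s, hs, hfs⟩ := intermediate_value_Icc ht.1 (hf.mono (Icc_subset_Icc_right ht.2))
    ⟨(h0 a ⟨le_rfl, hab⟩).le, hft⟩
  have hst : s = t := le_antisymm hs.2 (hmin ⟨⟨hs.1, hs.2.trans ht.2⟩, hfs.ge⟩)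
  refine ⟨t, ⟨hbt, ht.2⟩, hst ▸ hfs, fun u hu => ?_⟩
  rcases hu.2.eq_or_lt with rfl | h
  · exact (hst ▸ hfs).le
  · by_contra! h'
    exact absurd (hmin ⟨⟨hu.1, hu.2.trans ht.2⟩, h'.le⟩) (not_le.2 h)

/-- Grönwall's inequality from below. -/
lemma le_exp_mul_of_deriv_ge {V : ℝ → ℝ} {T r : ℝ} (hT : 0 ≤ T)
    (h : ∀ t ∈ Icc 0 T, ∃ V', HasDerivWithinAt V V' (Icc 0 T) t ∧ -r * V t ≤ V') :
    V 0 ≤ Real.exp (r * T) * V T := by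
  choose! V' hV' hle using h
  have hE : ∀ t, HasDerivAt (fun s => Real.exp (r * s)) (Real.exp (r * t) * r) t := fun t => by
    simpa using ((hasDerivAt_id t).const_mul r).exp
  have hder : ∀ t ∈ Icc 0 T, HasDerivWithinAt (fun s => Real.exp (r * s) * V s)
      (Real.exp (r * t) * r * V t + Real.exp (r * t) * V' t) (Icc 0 T) t :=
    fun t ht => (hE t).hasDerivWithinAt.mul (hV' t ht)
  have hmono : MonotoneOn (fun s => Real.exp (r * s) * V s) (Icc 0 T) := by
    refine monotoneOn_of_deriv_nonneg (convex_Icc _ _)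
      (fun t ht => (hder t ht).continuousWithinAt) ?_ ?_
    · intro t ht
      exact ((hder t (interior_subset ht)).mono interior_subset).differentiableWithinAt
    · intro t ht
      rw [interior_Icc] at ht
      rw [((hder t (Ioo_subset_Icc_self ht)).hasDerivAt (Icc_mem_nhds ht.1 ht.2)).deriv]
      have := hle t (Ioo_subset_Icc_self ht)
      have h2 := Real.exp_pos (r * t)
      nlinarith
  have := hmono (left_mem_Icc.2 hT) (right_mem_Icc.2 hT) hT
  simpa using this

lemma eq_of_hasDerivWithinAt_zero {V : ℝ → ℝ} {T : ℝ}
    (h : ∀ t ∈ Icc 0 T, HasDerivWithinAt V 0 (Icc 0 T) t) : ∀ t ∈ Icc 0 T, V t = V 0 := by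
  refine constant_of_has_deriv_right_zero (fun t ht => (h t ht).continuousWithinAt) ?_
  intro t ht
  exact (h t (Ico_subset_Icc_self ht)).mono_of_mem_nhdsWithin (Icc_mem_nhdsGE_of_mem ht)

end Delay

/-! ### Spectral decomposition of the weighted Laplacian -/

namespace CityModel

open Matrix

variable {n m : ℕ} (C : CityModel n m)

lemma lapMatrix_mulVec (x : Fin n → ℝ) (i : Fin n) :
    (C.lapMatrix *ᵥ x) i = ∑ j, C.r i j * (x i - x j) := by
  have h : ∀ j, C.lapMatrix i j * x j = (if i = j then (∑ k ∈ Finset.univ.erase i, C.r i k) * x i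
      + C.r i i * x i else 0) - C.r i j * x j := by
    intro j
    unfold lapMatrix
    rw [Matrix.of_apply]
    split_ifs with h
    · subst h; ring
    · ring
  simp only [mulVec, dotProduct]
  rw [Finset.sum_congr rfl fun j _ => h j, Finset.sum_sub_distrib, Finset.sum_ite_eq]
  simp only [Finset.mem_univ, if_true, mul_sub, Finset.sum_sub_distrib, ← Finset.sum_mul]
  rw [← add_mul, Finset.sum_erase_add _ _ (Finset.mem_univ i)]

/-- The quadratic form of the weighted Laplacian. -/
lemma dotProduct_lapMatrix_mulVec (x : Fin n → ℝ) :
    x ⬝ᵥ (C.lapMatrix *ᵥ x) = (∑ i, ∑ j, C.r i j * (x i - x j) ^ 2) / 2 := by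
  have h1 : x ⬝ᵥ (C.lapMatrix *ᵥ x) = ∑ i, ∑ j, C.r i j * (x i - x j) * x i := by
    simp only [dotProduct, lapMatrix_mulVec]
    refine Finset.sum_congr rfl fun i _ => ?_
    rw [mul_comm, Finset.sum_mul]
  have h2 : x ⬝ᵥ (C.lapMatrix *ᵥ x) = ∑ i, ∑ j, C.r i j * (x j - x i) * x j := by
    rw [h1, Finset.sum_comm]
    refine Finset.sum_congr rfl fun i _ => Finset.sum_congr rfl fun j _ => ?_
    rw [C.r_symm]
  have h3 : (∑ i, ∑ j, C.r i j * (x i - x j) ^ 2) =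
      x ⬝ᵥ (C.lapMatrix *ᵥ x) + x ⬝ᵥ (C.lapMatrix *ᵥ x) := by
    nth_rewrite 1 [h1]
    rw [h2, ← Finset.sum_add_distrib]
    refine Finset.sum_congr rfl fun i _ => ?_
    rw [← Finset.sum_add_distrib]
    refine Finset.sum_congr rfl fun j _ => ?_
    ring
  rw [h3]; ring

lemma lapMatrix_isHermitian : C.lapMatrix.IsHermitian := by
  refine Matrix.IsHermitian.ext fun i j => ?_
  unfold lapMatrix
  simp only [Matrix.of_apply, star_trivial]
  by_cases h : i = j
  · subst h; rfl
  · rw [if_neg h, if_neg (Ne.symm h), C.r_symm]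

/-- The eigenvalues of the weighted Laplacian. -/
noncomputable def eigval : Fin n → ℝ := C.lapMatrix_isHermitian.eigenvalues

/-- An orthonormal basis of eigenvectors of the weighted Laplacian. -/
noncomputable def mode (k : Fin n) : Fin n → ℝ := ⇑(C.lapMatrix_isHermitian.eigenvectorBasis k)

lemma lapMatrix_mulVec_mode (k : Fin n) : C.lapMatrix *ᵥ C.mode k = C.eigval k • C.mode k :=
  C.lapMatrix_isHermitian.mulVec_eigenvectorBasis k

lemma mode_dotProduct_lapMatrix_mulVec (k : Fin n) (x : Fin n → ℝ) :
    C.mode k ⬝ᵥ (C.lapMatrix *ᵥ x) = C.eigval k * (C.mode k ⬝ᵥ x) := by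
  have h : C.lapMatrixᵀ = C.lapMatrix := by
    simpa [Matrix.IsSymm] using C.lapMatrix_isHermitian
  rw [dotProduct_mulVec, ← mulVec_transpose, h, lapMatrix_mulVec_mode, smul_dotProduct, smul_eq_mul]

lemma mode_dotProduct_mode (k l : Fin n) : C.mode k ⬝ᵥ C.mode l = if k = l then 1 else 0 := by
  have h := orthonormal_iff_ite.1 C.lapMatrix_isHermitian.eigenvectorBasis.orthonormal l k
  rw [EuclideanSpace.inner_eq_star_dotProduct] at h
  simpa [mode, eq_comm] using h

/-- Parseval's identity for the eigenvector basis. -/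
lemma sum_sq_mode_dotProduct (x : Fin n → ℝ) : ∑ k, (C.mode k ⬝ᵥ x) ^ 2 = ∑ i, x i ^ 2 := by
  have h := C.lapMatrix_isHermitian.eigenvectorBasis.sum_sq_norm_inner_right (WithLp.toLp 2 x)
  rw [EuclideanSpace.norm_sq_eq] at h
  simpa [mode, EuclideanSpace.inner_eq_star_dotProduct, dotProduct_comm] using h

lemma eigval_eq (k : Fin n) :
    C.eigval k = (∑ i, ∑ j, C.r i j * (C.mode k i - C.mode k j) ^ 2) / 2 := by
  rw [← dotProduct_lapMatrix_mulVec, mode_dotProduct_lapMatrix_mulVec, mode_dotProduct_mode]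
  simp

lemma r_mul_sq_nonneg (x : Fin n → ℝ) (i j : Fin n) : 0 ≤ C.r i j * (x i - x j) ^ 2 := by
  by_cases h : i = j
  · subst h; simp
  · have := C.r_pos i j h
    positivity

lemma eigval_nonneg (k : Fin n) : 0 ≤ C.eigval k := by
  rw [eigval_eq]
  have := Finset.sum_nonneg fun i (_ : i ∈ Finset.univ) =>
    Finset.sum_nonneg fun j (_ : j ∈ Finset.univ) => C.r_mul_sq_nonneg (C.mode k) i j
  positivity

/-- The kernel of the weighted Laplacian consists of the constant vectors. -/
lemma mode_dotProduct_eq_zero {k : Fin n} (hk : C.eigval k = 0) {x : Fin n → ℝ}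
    (hx : ∑ i, x i = 0) : C.mode k ⬝ᵥ x = 0 := by
  have hsum : ∑ i, ∑ j, C.r i j * (C.mode k i - C.mode k j) ^ 2 = 0 := by
    have := C.eigval_eq k
    linarith
  have hconst : ∀ i j, C.mode k i = C.mode k j := by
    intro i j
    by_cases h : i = j
    · rw [h]
    have h1 := (Finset.sum_eq_zero_iff_of_nonneg fun i _ =>
      Finset.sum_nonneg fun j _ => C.r_mul_sq_nonneg (C.mode k) i j).1 hsum i (Finset.mem_univ i)
    have h2 := (Finset.sum_eq_zero_iff_of_nonneg fun j _ =>
      C.r_mul_sq_nonneg (C.mode k) i j).1 h1 j (Finset.mem_univ j)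
    rcases mul_eq_zero.1 h2 with h3 | h3
    · exact absurd h3 (C.r_pos i j h).ne'
    · exact sub_eq_zero.1 (pow_eq_zero_iff two_ne_zero |>.1 h3)
  rw [dotProduct, Finset.sum_congr rfl fun i _ => by rw [hconst i k], ← Finset.mul_sum, hx,
    mul_zero]

lemma sum_lapMatrix_mulVec (x : Fin n → ℝ) : ∑ i, (C.lapMatrix *ᵥ x) i = 0 := by
  have h1 : ∑ i, (C.lapMatrix *ᵥ x) i = ∑ i, ∑ j, C.r i j * (x i - x j) :=
    Finset.sum_congr rfl fun i _ => C.lapMatrix_mulVec x i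
  have h2 : ∑ i, ∑ j, C.r i j * (x i - x j) = -∑ i, ∑ j, C.r i j * (x i - x j) := by
    nth_rewrite 1 [Finset.sum_comm]
    rw [← Finset.sum_neg_distrib]
    refine Finset.sum_congr rfl fun i _ => ?_
    rw [← Finset.sum_neg_distrib]
    refine Finset.sum_congr rfl fun j _ => ?_
    rw [C.r_symm]; ring
  linarith

/-- Modes of nonzero eigenvalues have mean zero. -/
lemma sum_mode {k : Fin n} (hk : C.eigval k ≠ 0) : ∑ i, C.mode k i = 0 := by
  have h := C.sum_lapMatrix_mulVec (C.mode k)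
  rw [lapMatrix_mulVec_mode] at h
  simp only [Pi.smul_apply, smul_eq_mul, ← Finset.mul_sum] at h
  exact (mul_eq_zero.1 h).resolve_left hk

lemma exists_eigval_pos (hn : 2 ≤ n) : ∃ k, 0 < C.eigval k := by
  by_contra! h
  have h0 : ∀ k, C.eigval k = 0 := fun k => le_antisymm (h k) (C.eigval_nonneg k)
  let i : Fin n := ⟨0, by omega⟩
  let j : Fin n := ⟨1, by omega⟩
  have hij : i ≠ j := by simp [i, j]
  let x : Fin n → ℝ := Pi.single i 1 - Pi.single j 1
  have hx : ∑ i, x i = 0 := by simp [x, Finset.sum_sub_distrib]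
  have h1 := C.sum_sq_mode_dotProduct x
  rw [Finset.sum_eq_zero fun k _ => by rw [C.mode_dotProduct_eq_zero (h0 k) hx]; norm_num] at h1
  have h2 := (Finset.sum_eq_zero_iff_of_nonneg fun i _ => sq_nonneg (x i)).1 h1.symm i
    (Finset.mem_univ i)
  simp [x, Pi.single_eq_of_ne hij] at h2

/-- Eigenvalues of the complexified weighted Laplacian. -/
lemma exists_eq_eigval_of_det_eq_zero {ζ : ℂ}
    (h : (ζ • (1 : Matrix (Fin n) (Fin n) ℂ) - C.lapMatrix.map (fun x : ℝ => (x : ℂ))).det = 0) :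
    ∃ k, ζ = C.eigval k := by
  have h1 : (C.lapMatrix.map (fun x : ℝ => (x : ℂ))).charpoly.eval ζ = 0 := by
    rw [Matrix.eval_charpoly, ← h]
    congr 2
    ext i j
    simp [Matrix.scalar_apply, Matrix.diagonal_apply, Matrix.one_apply]
  have h2 : (C.lapMatrix.map (fun x : ℝ => (x : ℂ))).charpoly =
      C.lapMatrix.charpoly.map Complex.ofRealHom :=
    Matrix.charpoly_map C.lapMatrix Complex.ofRealHom
  rw [h2, C.lapMatrix_isHermitian.charpoly_eq, Polynomial.eval_map, Polynomial.eval₂_finsetProd,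
    Finset.prod_eq_zero_iff] at h1
  obtain ⟨k, -, hk⟩ := h1
  refine ⟨k, ?_⟩
  simp only [Polynomial.eval₂_sub, Polynomial.eval₂_X, Polynomial.eval₂_C] at hk
  exact sub_eq_zero.1 hk

/-- A root of the characteristic equation is a root of the scalar characteristic equation of one of
the modes. -/
lemma exists_eq_eigval_mul_of_charFun_eq_zero {z : ℂ} (h : C.charFun z = 0) (hz : z ≠ 0) :
    ∃ k, z = C.eigval k * (C.Φ₁ * Complex.exp (-(z * C.τ)) - C.Φ₂) := by
  unfold charFun at h
  set c : ℂ := C.Φ₁ * Complex.exp (-(z * C.τ)) - C.Φ₂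
  have hc : c ≠ 0 := by
    intro hc
    rw [hc, zero_smul, sub_zero, Matrix.det_smul, Matrix.det_one, mul_one] at h
    exact hz (eq_zero_of_pow_eq_zero h)
  have h2 : z • (1 : Matrix (Fin n) (Fin n) ℂ) - c • C.lapMatrix.map (fun x : ℝ => (x : ℂ)) =
      c • ((z / c) • (1 : Matrix (Fin n) (Fin n) ℂ) - C.lapMatrix.map (fun x : ℝ => (x : ℂ))) := by
    rw [smul_sub, smul_smul, mul_div_cancel₀ _ hc]
  rw [h2, Matrix.det_smul] at h
  obtain ⟨k, hk⟩ := C.exists_eq_eigval_of_det_eq_zero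
    ((mul_eq_zero.1 h).resolve_left (pow_ne_zero _ hc))
  exact ⟨k, by rw [← hk, div_mul_cancel₀ _ hc]⟩

theorem charFun_roots (h1 : 0 ≤ C.Φ₁) (h12 : C.Φ₁ < C.Φ₂) {z : ℂ} (hz : C.charFun z = 0) :
    z = 0 ∨ z.re < 0 := by
  by_cases h0 : z = 0
  · exact Or.inl h0
  refine Or.inr ?_
  obtain ⟨k, hk⟩ := C.exists_eq_eigval_mul_of_charFun_eq_zero hz h0
  have hμ : 0 < C.eigval k := by
    refine lt_of_le_of_ne (C.eigval_nonneg k) fun h => h0 ?_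
    rw [hk, ← h]; simp
  by_contra! hre
  have h3 : (Complex.exp (-(z * C.τ))).re ≤ 1 := by
    refine (Complex.re_le_norm _).trans ?_
    rw [Complex.norm_exp]
    simp only [Complex.neg_re, Complex.mul_re, Complex.ofReal_re, Complex.ofReal_im, mul_zero,
      sub_zero, Real.exp_le_one_iff, Left.neg_nonpos_iff]
    exact mul_nonneg hre C.τ_pos.le
  have h4 : z.re = C.eigval k * (C.Φ₁ * (Complex.exp (-(z * C.τ))).re - C.Φ₂) := by
    nth_rewrite 1 [hk]
    rw [Complex.re_ofReal_mul, Complex.sub_re, Complex.re_ofReal_mul, Complex.ofReal_re]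
  have h5 : C.Φ₁ * (Complex.exp (-(z * C.τ))).re ≤ C.Φ₁ := by nlinarith
  nlinarith

end CityModel

/-! ### The vector field near the equal-size state -/

namespace CityModel

open Matrix

variable {n m : ℕ} (C : CityModel n m)

lemma share_pos (hn : 2 ≤ n) : 0 < C.share := by
  unfold share
  positivity

lemma share_lt_one (hn : 2 ≤ n) : C.share < 1 := by
  unfold share
  have : (2 : ℝ) ≤ n := by exact_mod_cast hn
  rw [div_lt_one (by positivity)]
  linarith

lemma share_mem_Icc (hn : 2 ≤ n) : C.share ∈ Icc (0 : ℝ) 1 :=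
  ⟨(C.share_pos hn).le, (C.share_lt_one hn).le⟩

lemma need_pos {p : ℝ} (hp : 0 < p) (l : Fin m) : 0 < C.need l p :=
  mul_pos (C.Y₀_pos l) (Real.rpow_pos_of_pos (mul_pos hp C.N_pos) _)

lemma sum_equalState (hn : 2 ≤ n) : ∑ i, C.equalState i = 1 := by
  have : (n : ℝ) ≠ 0 := by positivity
  simp [equalState, share, this]

lemma hasStrictDerivAt_need {p : ℝ} (hp : 0 < p) (l : Fin m) :
    HasStrictDerivAt (C.need l) (C.need l p * C.β l / p) p := by
  have hpN : p * C.N ≠ 0 := (mul_pos hp C.N_pos).ne'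
  have h1 : HasStrictDerivAt (fun p => p * C.N) C.N p := by
    simpa using (hasStrictDerivAt_id p).mul_const C.N
  have h2 := ((Real.hasStrictDerivAt_rpow_const_of_ne hpN (C.β l)).comp p h1).const_mul (C.Y₀ l)
  refine h2.congr_deriv ?_
  rw [Real.rpow_sub_one hpN]
  unfold need
  have := C.N_pos.ne'
  field_simp

/-- The derivative of the utility with respect to the current and to the delayed share. -/
lemma hasStrictFDerivAt_utility (hn : 2 ≤ n) (hX : ∀ l, ContDiffAt ℝ 1 (C.X l) C.share) :
    HasStrictFDerivAt (fun z : ℝ × ℝ => C.utility z.1 z.2)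
      ((-(C.Φ₂ / C.share ^ 2)) • ContinuousLinearMap.fst ℝ ℝ ℝ
        + (C.Φ₁ / C.share ^ 2) • ContinuousLinearMap.snd ℝ ℝ ℝ) (C.share, C.share) := by
  have hs := C.share_pos hn
  have hterm : ∀ l, HasStrictFDerivAt
      (fun z : ℝ × ℝ => C.α l * Real.log (1 + C.X l z.2 / C.need l z.1))
      ((-(C.margin l * (C.β l * (C.X l C.share / C.share)))) • ContinuousLinearMap.fst ℝ ℝ ℝ
        + (C.margin l * deriv (C.X l) C.share) • ContinuousLinearMap.snd ℝ ℝ ℝ)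
      (C.share, C.share) := by
    intro l
    have hY := C.need_pos hs l
    have hXn := C.X_nonneg l _ (C.share_mem_Icc hn)
    have hpos : 0 < 1 + C.X l C.share * (C.need l C.share)⁻¹ := by positivity
    have h1 : HasStrictFDerivAt (fun z : ℝ × ℝ => C.X l z.2)
        (deriv (C.X l) C.share • ContinuousLinearMap.snd ℝ ℝ ℝ) (C.share, C.share) :=
      ((hX l).hasStrictDerivAt one_ne_zero).comp_hasStrictFDerivAt (C.share, C.share)
        hasStrictFDerivAt_snd
    have h0 : HasStrictDerivAt (fun p => (C.need l p)⁻¹) _ C.share :=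
      (hasStrictDerivAt_inv hY.ne').comp _ (C.hasStrictDerivAt_need hs l)
    have hfst : HasStrictFDerivAt (fun z : ℝ × ℝ => z.1) (ContinuousLinearMap.fst ℝ ℝ ℝ)
      (C.share, C.share) := hasStrictFDerivAt_fst
    have h2 : HasStrictFDerivAt (fun z : ℝ × ℝ => (C.need l z.1)⁻¹) _ (C.share, C.share) :=
      HasStrictDerivAt.comp_hasStrictFDerivAt (h₂ := fun p => (C.need l p)⁻¹) (C.share, C.share)
        h0 hfst
    have h3 := (((h1.mul h2).const_add 1).log hpos.ne').const_mul (C.α l)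
    simp only [div_eq_mul_inv]
    refine h3.congr_fderiv ?_
    ext
    · simp only [margin]
      simp
      field_simp
    · simp only [margin]
      simp
      field_simp
  have h := HasStrictFDerivAt.fun_sum (u := Finset.univ) fun l _ => hterm l
  refine h.congr_fderiv ?_
  rw [Finset.sum_add_distrib, ← Finset.sum_smul, ← Finset.sum_smul]
  congr 2
  · rw [Finset.sum_neg_distrib, Φ₂, mul_div_cancel_left₀ _ (by positivity)]
  · rw [Φ₁, mul_div_cancel_left₀ _ (by positivity)]

/-- The linearization of the vector field at the equal-size state: `(x, y)` is mapped to
`M (Φ₁ y - Φ₂ x)`, where `M` is the weighted Laplacian. -/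
noncomputable def linearPart : (Fin n → ℝ) × (Fin n → ℝ) →L[ℝ] (Fin n → ℝ) :=
  (LinearMap.toContinuousLinearMap C.lapMatrix.mulVecLin).comp
    (C.Φ₁ • ContinuousLinearMap.snd ℝ (Fin n → ℝ) (Fin n → ℝ)
      - C.Φ₂ • ContinuousLinearMap.fst ℝ (Fin n → ℝ) (Fin n → ℝ))

lemma linearPart_apply (x y : Fin n → ℝ) :
    C.linearPart (x, y) = C.lapMatrix *ᵥ (C.Φ₁ • y - C.Φ₂ • x) := by
  simp only [linearPart, ContinuousLinearMap.comp_apply, _root_.sub_apply,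
    _root_.smul_apply, ContinuousLinearMap.coe_fst', ContinuousLinearMap.coe_snd',
    LinearMap.coe_toContinuousLinearMap', Matrix.mulVecLin_apply]

lemma field_apply (p q : Fin n → ℝ) (i : Fin n) : C.field p q i =
    ∑ j, C.r i j * ((p i * p j) * (C.utility (p i) (q i) - C.utility (p j) (q j))) := by
  unfold field
  rw [Finset.sum_erase _ (by simp), Finset.mul_sum]
  exact Finset.sum_congr rfl fun j _ => by ring

lemma hasStrictFDerivAt_field (hn : 2 ≤ n) (hX : ∀ l, ContDiffAt ℝ 1 (C.X l) C.share) :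
    HasStrictFDerivAt (fun z : (Fin n → ℝ) × (Fin n → ℝ) => C.field z.1 z.2) C.linearPart
      (C.equalState, C.equalState) := by
  have hs := C.share_pos hn
  set e := (C.equalState, C.equalState)
  let P : Fin n → (Fin n → ℝ) × (Fin n → ℝ) →L[ℝ] ℝ := fun i =>
    (ContinuousLinearMap.proj i).comp (ContinuousLinearMap.fst ℝ _ _)
  let Q : Fin n → (Fin n → ℝ) × (Fin n → ℝ) →L[ℝ] ℝ := fun i =>
    (ContinuousLinearMap.proj i).comp (ContinuousLinearMap.snd ℝ _ _)
  have hP : ∀ i, HasStrictFDerivAt (fun z : (Fin n → ℝ) × (Fin n → ℝ) => z.1 i) (P i) e :=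
    fun i => (P i).hasStrictFDerivAt
  have hQ : ∀ i, HasStrictFDerivAt (fun z : (Fin n → ℝ) × (Fin n → ℝ) => z.2 i) (Q i) e :=
    fun i => (Q i).hasStrictFDerivAt
  have hU : ∀ i, HasStrictFDerivAt
      (fun z : (Fin n → ℝ) × (Fin n → ℝ) => C.utility (z.1 i) (z.2 i)) _ e := fun i =>
    HasStrictFDerivAt.comp (g := fun z : ℝ × ℝ => C.utility z.1 z.2) e
      (C.hasStrictFDerivAt_utility hn hX) ((hP i).prodMk (hQ i))
  refine hasStrictFDerivAt_pi'' fun i => ?_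
  simp only [field_apply]
  have h := HasStrictFDerivAt.fun_sum (u := Finset.univ) fun j (_ : j ∈ Finset.univ) =>
    (((hP i).mul (hP j)).mul ((hU i).sub (hU j))).const_mul (C.r i j)
  refine h.congr_fderiv ?_
  refine ContinuousLinearMap.ext fun ⟨x, y⟩ => ?_
  rw [ContinuousLinearMap.comp_apply, linearPart_apply, ContinuousLinearMap.proj_apply,
    lapMatrix_mulVec, _root_.sum_apply]
  refine Finset.sum_congr rfl fun j _ => ?_
  simp [e, P, Q, equalState]
  left
  field_simp
  ring

lemma field_equalState : C.field C.equalState C.equalState = 0 := by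
  ext i
  rw [field_apply]
  simp [equalState]

lemma sum_field (p q : Fin n → ℝ) : ∑ i, C.field p q i = 0 := by
  have h1 : ∑ i, C.field p q i = -∑ i, C.field p q i := by
    simp only [field_apply]
    nth_rewrite 1 [Finset.sum_comm]
    rw [← Finset.sum_neg_distrib]
    refine Finset.sum_congr rfl fun i _ => ?_
    rw [← Finset.sum_neg_distrib]
    refine Finset.sum_congr rfl fun j _ => ?_
    rw [C.r_symm]; ring
  linarith

theorem isEquilibrium_equalState (hn : 2 ≤ n) : C.IsEquilibrium C.equalState := fun T _ =>
  { history := fun _ _ => rfl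
    continuousOn := continuousOn_const
    mem_simplex := fun _ _ => ⟨fun _ => (C.share_pos hn).le, C.sum_equalState hn⟩
    deriv_eq := fun t _ => by
      rw [field_equalState]
      exact hasDerivWithinAt_const _ _ _ }

lemma norm_sq_le_sum_sq (x : Fin n → ℝ) : ‖x‖ ^ 2 ≤ ∑ i, x i ^ 2 := by
  have h : ‖x‖ ≤ √(∑ i, x i ^ 2) := by
    refine (pi_norm_le_iff_of_nonneg (Real.sqrt_nonneg _)).2 fun i => ?_
    rw [Real.norm_eq_abs, ← Real.sqrt_sq_eq_abs]
    exact Real.sqrt_le_sqrt (Finset.single_le_sum (f := fun i => x i ^ 2)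
      (fun i _ => sq_nonneg (x i)) (Finset.mem_univ i))
  calc ‖x‖ ^ 2 ≤ √(∑ i, x i ^ 2) ^ 2 := pow_le_pow_left₀ (norm_nonneg _) h 2
    _ = _ := Real.sq_sqrt (Finset.sum_nonneg fun i _ => sq_nonneg (x i))

lemma sum_sq_le (x : Fin n → ℝ) : ∑ i, x i ^ 2 ≤ n * ‖x‖ ^ 2 := by
  have : ∀ i ∈ Finset.univ, x i ^ 2 ≤ ‖x‖ ^ 2 := fun i _ => by
    rw [← sq_abs]
    exact pow_le_pow_left₀ (abs_nonneg _) (norm_le_pi_norm x i) 2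
  simpa using Finset.sum_le_card_nsmul _ _ _ this

/-- In the coordinates of the modes, the vector field is its linearization up to a remainder that is
small relative to the deviations `p - e` and `q - e` from the equal-size state `e`. -/
lemma exists_remainder_bound (hn : 2 ≤ n) (hX : ∀ l, ContDiffAt ℝ 1 (C.X l) C.share) {η : ℝ}
    (hη : 0 < η) :
    ∃ δ > 0, ∀ p q : Fin n → ℝ, dist p C.equalState ≤ δ → dist q C.equalState ≤ δ →
      ∑ k, (C.mode k ⬝ᵥ C.field p q - (C.Φ₁ * C.eigval k * (C.mode k ⬝ᵥ (q - C.equalState))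
        - C.Φ₂ * C.eigval k * (C.mode k ⬝ᵥ (p - C.equalState)))) ^ 2 ≤
      η * ∑ k, ((C.mode k ⬝ᵥ (p - C.equalState)) ^ 2
        + (C.mode k ⬝ᵥ (q - C.equalState)) ^ 2) := by
  have hn0 : (0 : ℝ) < n := by positivity
  have hc : 0 < √(η / n) := Real.sqrt_pos.2 (by positivity)
  have h := (C.hasStrictFDerivAt_field hn hX).hasFDerivAt.isLittleO.def hc
  rw [Metric.eventually_nhds_iff_ball] at h
  obtain ⟨δ, hδ, h⟩ := h
  refine ⟨δ / 2, by positivity, fun p q hp hq => ?_⟩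
  have hpq := h (p, q) (by
    rw [Metric.mem_ball, Prod.dist_eq]
    exact max_lt (by linarith) (by linarith))
  simp only [field_equalState, sub_zero, Prod.mk_sub_mk, linearPart_apply] at hpq
  set x := p - C.equalState
  set y := q - C.equalState
  clear_value x y
  set R := C.field p q - C.lapMatrix *ᵥ (C.Φ₁ • y - C.Φ₂ • x)
  have hR : ∀ k, C.mode k ⬝ᵥ C.field p q - (C.Φ₁ * C.eigval k * (C.mode k ⬝ᵥ y)
      - C.Φ₂ * C.eigval k * (C.mode k ⬝ᵥ x)) = C.mode k ⬝ᵥ R := by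
    intro k
    rw [dotProduct_sub, mode_dotProduct_lapMatrix_mulVec, dotProduct_sub, dotProduct_smul,
      dotProduct_smul, smul_eq_mul, smul_eq_mul]
    ring
  simp only [hR, Finset.sum_add_distrib, sum_sq_mode_dotProduct]
  have h1 : ‖(x, y)‖ ^ 2 ≤ ∑ i, x i ^ 2 + ∑ i, y i ^ 2 := by
    have hx := norm_sq_le_sum_sq x
    have hy := norm_sq_le_sum_sq y
    rw [Prod.norm_def]
    rcases max_choice ‖x‖ ‖y‖ with h | h
    · simp only [h]; nlinarith [sq_nonneg ‖y‖]
    · simp only [h]; nlinarith [sq_nonneg ‖x‖]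
  calc ∑ i, R i ^ 2 ≤ n * ‖R‖ ^ 2 := sum_sq_le R
    _ ≤ n * (√(η / n) * ‖(x, y)‖) ^ 2 := by gcongr
    _ = η * ‖(x, y)‖ ^ 2 := by
      rw [mul_pow, Real.sq_sqrt (by positivity)]
      field_simp
    _ ≤ _ := by gcongr

/-! ### Existence of solutions near the equal-size state -/

/-- The retraction of the space of all states to the cube of radius `δ` about the equal-size
state. -/
noncomputable def clamp (δ : ℝ) (p : Fin n → ℝ) : Fin n → ℝ := fun i =>
  max (C.share - δ) (min (p i) (C.share + δ))

lemma lipschitzWith_clamp (δ : ℝ) : LipschitzWith 1 (C.clamp δ) := by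
  refine LipschitzWith.of_dist_le_mul fun p q => ?_
  rw [NNReal.coe_one, one_mul]
  refine (dist_pi_le_iff dist_nonneg).2 fun i => ?_
  refine le_trans ?_ (dist_le_pi_dist p q i)
  rw [Real.dist_eq, Real.dist_eq]
  unfold clamp
  refine (abs_max_sub_max_le_max _ _ _ _).trans ?_
  rw [sub_self, abs_zero]
  refine max_le (abs_nonneg _) ((abs_min_sub_min_le_max _ _ _ _).trans ?_)
  rw [sub_self, abs_zero]
  exact max_le le_rfl (abs_nonneg _)

lemma dist_clamp_le {δ : ℝ} (hδ : 0 ≤ δ) (p : Fin n → ℝ) : dist (C.clamp δ p) C.equalState ≤ δ := by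
  refine (dist_pi_le_iff hδ).2 fun i => ?_
  rw [Real.dist_eq, abs_le]
  unfold clamp equalState
  constructor
  · linarith [le_max_left (C.share - δ) (min (p i) (C.share + δ))]
  · have : max (C.share - δ) (min (p i) (C.share + δ)) ≤ C.share + δ :=
      max_le (by linarith) (min_le_right _ _)
    linarith

lemma clamp_eq_self {δ : ℝ} {p : Fin n → ℝ} (h : dist p C.equalState ≤ δ) : C.clamp δ p = p := by
  ext i
  have hi := (dist_le_pi_dist p C.equalState i).trans h
  rw [Real.dist_eq, abs_le] at hi
  unfold equalState at hi
  unfold clamp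
  rw [min_eq_left (by linarith), max_eq_right (by linarith)]

lemma mem_stdSimplex_of_dist_le {p : Fin n → ℝ} (h : dist p C.equalState ≤ C.share)
    (hsum : ∑ i, p i = 1) : p ∈ stdSimplex ℝ (Fin n) := by
  refine ⟨fun i => ?_, hsum⟩
  have hi := (dist_le_pi_dist p C.equalState i).trans h
  rw [Real.dist_eq, abs_le] at hi
  unfold equalState at hi
  linarith

/-- Every history is the beginning of a curve that solves the equation as long as it stays near the
equal-size state: the solution of the equation with a clamped right-hand side. -/
lemma exists_local_solution (hn : 2 ≤ n) (hX : ∀ l, ContDiffAt ℝ 1 (C.X l) C.share) :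
    ∃ δ > 0, ∀ φ, C.IsHistory φ → ∃ p : ℝ → Fin n → ℝ, (∀ t ∈ Icc (-C.τ) 0, p t = φ t) ∧
      ∀ T, 0 ≤ T → ContinuousOn p (Icc (-C.τ) T) ∧
        (∀ t ∈ Icc (-C.τ) T, ∑ i, p t i = 1) ∧
        ∀ t ∈ Icc 0 T, dist (p t) C.equalState ≤ δ → dist (p (t - C.τ)) C.equalState ≤ δ →
          HasDerivWithinAt p (C.field (p t) (p (t - C.τ))) (Icc 0 T) t := by
  obtain ⟨K, s, hs, hK⟩ := (C.hasStrictFDerivAt_field hn hX).exists_lipschitzOnWith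
  obtain ⟨δ, hδ, hball⟩ := Metric.nhds_basis_closedBall.mem_iff.1 hs
  refine ⟨δ, hδ, fun φ hφ => ?_⟩
  let cl : (Fin n → ℝ) × (Fin n → ℝ) → (Fin n → ℝ) × (Fin n → ℝ) :=
    fun z => (C.clamp δ z.1, C.clamp δ z.2)
  have hclmem : ∀ z, cl z ∈ Metric.closedBall (C.equalState, C.equalState) δ := fun z => by
    rw [Metric.mem_closedBall, Prod.dist_eq]
    exact max_le (C.dist_clamp_le hδ.le _) (C.dist_clamp_le hδ.le _)
  have hcl : LipschitzWith 1 cl := by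
    have := ((C.lipschitzWith_clamp δ).comp LipschitzWith.prod_fst).prodMk
      ((C.lipschitzWith_clamp δ).comp (LipschitzWith.prod_snd (α := Fin n → ℝ)))
    simpa using this
  let f : (Fin n → ℝ) × (Fin n → ℝ) → Fin n → ℝ := fun z => C.field (cl z).1 (cl z).2
  have hf : LipschitzWith K f := by
    refine LipschitzWith.of_dist_le_mul fun z z' => ?_
    refine (hK.dist_le_mul _ (hball (hclmem z)) _ (hball (hclmem z'))).trans ?_
    have := hcl.dist_le_mul z z'
    rw [NNReal.coe_one, one_mul] at this
    gcongr
  have hbound : ∀ z, ‖f z‖ ≤ ((K * δ.toNNReal : NNReal) : ℝ) := by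
    intro z
    have h1 := hK.dist_le_mul _ (hball (hclmem z)) _ (mem_of_mem_nhds hs)
    rw [C.field_equalState, dist_zero_right] at h1
    refine h1.trans ?_
    rw [NNReal.coe_mul, Real.coe_toNNReal _ hδ.le]
    have := Metric.mem_closedBall.1 (hclmem z)
    gcongr
  have hle : -C.τ ≤ 0 := by linarith [C.τ_pos]
  have hφc : Continuous fun t => φ (projIcc (-C.τ) 0 hle t) :=
    hφ.1.comp_continuous (continuous_subtype_val.comp continuous_projIcc)
      fun t => (projIcc (-C.τ) 0 hle t).2
  obtain ⟨p, hp0, hp⟩ := exists_delay_solution hf hbound C.τ_pos hφc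
  have hhist : ∀ t ∈ Icc (-C.τ) 0, p t = φ t := fun t ht => by
    rw [hp0 t ht.2, projIcc_of_mem hle ht]
  refine ⟨p, hhist, fun T hT => ⟨(hp T hT).1.mono Icc_subset_Iic_self, ?_, ?_⟩⟩
  · have hsum0 : ∀ t ∈ Icc (-C.τ) 0, ∑ i, p t i = 1 := fun t ht => by
      rw [hhist t ht]; exact (hφ.2 t ht).2
    have hsum : ∀ t ∈ Icc 0 T, ∑ i, p t i = ∑ i, p 0 i := by
      refine eq_of_hasDerivWithinAt_zero fun t ht => ?_
      have h := HasDerivWithinAt.fun_sum (u := Finset.univ) fun i (_ : i ∈ Finset.univ) =>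
        hasDerivWithinAt_pi.1 ((hp T hT).2 t ht) i
      rwa [C.sum_field] at h
    intro t ht
    rcases le_total t 0 with h | h
    · exact hsum0 t ⟨ht.1, h⟩
    · rw [hsum t ⟨h, ht.2⟩, hsum0 0 ⟨hle, le_rfl⟩]
  · intro t ht h1 h2
    have h := (hp T hT).2 t ht
    simpa only [f, cl, C.clamp_eq_self h1, C.clamp_eq_self h2] using h

end CityModel

/-! ### Asymptotic stability -/

/-- A finite family of real numbers has a positive lower bound for its positive members. -/
lemma exists_gap {ι : Type*} [Finite ι] (c : ι → ℝ) : ∃ g > 0, ∀ k, 0 < c k → g ≤ c k := by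
  have h : ∀ᶠ g in 𝓝[>] (0 : ℝ), 0 < g ∧ ∀ k, 0 < c k → g ≤ c k := by
    refine Eventually.and (eventually_mem_nhdsWithin) (eventually_all.2 fun k => ?_)
    by_cases hk : 0 < c k
    · filter_upwards [Ioo_mem_nhdsGT hk] with g hg _ using hg.2.le
    · exact Eventually.of_forall fun g h => absurd h hk
  exact h.exists

namespace CityModel

open Matrix

variable {n m : ℕ} (C : CityModel n m)

/-- The curve `p` solves the equation at those times in `[0, T]` at which its present and its
delayed state are within `ρ` of the equal-size state. -/
def SolvesNear (ρ T : ℝ) (p : ℝ → Fin n → ℝ) : Prop :=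
  ContinuousOn p (Icc (-C.τ) T) ∧
    ∀ t ∈ Icc 0 T, dist (p t) C.equalState ≤ ρ → dist (p (t - C.τ)) C.equalState ≤ ρ →
      HasDerivWithinAt p (C.field (p t) (p (t - C.τ))) (Icc 0 T) t

variable {C}

lemma SolvesNear.mono {ρ ρ' T T' : ℝ} {p : ℝ → Fin n → ℝ} (h : C.SolvesNear ρ T p) (hρ : ρ' ≤ ρ)
    (hT : T' ≤ T) : C.SolvesNear ρ' T' p :=
  ⟨h.1.mono (Icc_subset_Icc_right hT), fun t ht h1 h2 =>
    (h.2 t ⟨ht.1, ht.2.trans hT⟩ (h1.trans hρ) (h2.trans hρ)).mono (Icc_subset_Icc_right hT)⟩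

lemma SolvesNear.continuousOn_dist {ρ T : ℝ} {p : ℝ → Fin n → ℝ} (h : C.SolvesNear ρ T p) :
    ContinuousOn (fun t => dist (p t) C.equalState) (Icc (-C.τ) T) :=
  (continuous_id.dist continuous_const).comp_continuousOn h.1

lemma IsSolutionOn.solvesNear {φ p : ℝ → Fin n → ℝ} {T : ℝ} (h : C.IsSolutionOn φ T p) (ρ : ℝ) :
    C.SolvesNear ρ T p :=
  ⟨h.continuousOn, fun t ht _ _ => h.deriv_eq t ht⟩

lemma SolvesNear.isSolutionOn {φ p : ℝ → Fin n → ℝ} {ρ T : ℝ} (h : C.SolvesNear ρ T p)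
    (hhist : ∀ t ∈ Icc (-C.τ) 0, p t = φ t) (hsum : ∀ t ∈ Icc (-C.τ) T, ∑ i, p t i = 1)
    (hρ : ρ ≤ C.share) (hnear : ∀ t ∈ Icc (-C.τ) T, dist (p t) C.equalState ≤ ρ) :
    C.IsSolutionOn φ T p where
  history := hhist
  continuousOn := h.1
  mem_simplex t ht := C.mem_stdSimplex_of_dist_le ((hnear t ht).trans hρ) (hsum t ht)
  deriv_eq t ht := h.2 t ht
    (hnear t ⟨by linarith [ht.1, C.τ_pos], ht.2⟩)
    (hnear (t - C.τ) ⟨by linarith [ht.1], by linarith [ht.2, C.τ_pos]⟩)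

variable (C)

lemma sq_mode_dotProduct_le (x : Fin n → ℝ) (k : Fin n) : (C.mode k ⬝ᵥ x) ^ 2 ≤ n * ‖x‖ ^ 2 :=
  (Finset.single_le_sum (f := fun k => (C.mode k ⬝ᵥ x) ^ 2) (fun _ _ => sq_nonneg _)
    (Finset.mem_univ k)).trans ((C.sum_sq_mode_dotProduct x).le.trans (sum_sq_le x))

lemma abs_mode_dotProduct_le {x : Fin n → ℝ} {d : ℝ} (hx : ‖x‖ ≤ d) (k : Fin n) :
    |C.mode k ⬝ᵥ x| ≤ √n * d := by
  have hd : 0 ≤ d := (norm_nonneg x).trans hx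
  refine abs_le_of_sq_le_sq ?_ (by positivity)
  rw [mul_pow, Real.sq_sqrt (by positivity)]
  exact (C.sq_mode_dotProduct_le x k).trans (by gcongr)

/-- The coordinates `u k` of a solution near the equal-size state with respect to the modes solve
scalar delay equations up to a small remainder; they are extended to continuous functions on the
real line. -/
lemma exists_modal_coordinates (hn : 2 ≤ n) (hX : ∀ l, ContDiffAt ℝ 1 (C.X l) C.share) {η : ℝ}
    (hη : 0 < η) :
    ∃ ρ > 0, ∀ T, 0 ≤ T → ∀ p : ℝ → Fin n → ℝ, C.SolvesNear ρ T p →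
      (∀ t ∈ Icc (-C.τ) T, dist (p t) C.equalState ≤ ρ) →
      ∃ u R : Fin n → ℝ → ℝ, (∀ k, Continuous (u k)) ∧
        (∀ k, ∀ t ∈ Icc (-C.τ) T, u k t = C.mode k ⬝ᵥ (p t - C.equalState)) ∧
        (∀ k, ∀ t ∈ Icc 0 T, HasDerivWithinAt (u k)
          (C.Φ₁ * C.eigval k * u k (t - C.τ) - C.Φ₂ * C.eigval k * u k t + R k t) (Icc 0 T) t) ∧
        ∀ t ∈ Icc 0 T, ∑ k, R k t ^ 2 ≤ η * ∑ k, (u k t ^ 2 + u k (t - C.τ) ^ 2) := by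
  obtain ⟨ρ, hρ, hR⟩ := C.exists_remainder_bound hn hX hη
  refine ⟨ρ, hρ, fun T hT p hp hnear => ?_⟩
  have hτ := C.τ_pos
  have hle : -C.τ ≤ T := by linarith
  have hpc : Continuous fun t => p (projIcc (-C.τ) T hle t) :=
    hp.1.comp_continuous (continuous_subtype_val.comp continuous_projIcc)
      fun t => (projIcc (-C.τ) T hle t).2
  have hu : ∀ k, ∀ t ∈ Icc (-C.τ) T, C.mode k ⬝ᵥ (p (projIcc (-C.τ) T hle t) - C.equalState) =
      C.mode k ⬝ᵥ (p t - C.equalState) := fun k t ht => by rw [projIcc_of_mem hle ht]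
  have h1 : ∀ t ∈ Icc 0 T, t ∈ Icc (-C.τ) T := fun t ht => ⟨by linarith [ht.1], ht.2⟩
  have h2 : ∀ t ∈ Icc 0 T, t - C.τ ∈ Icc (-C.τ) T := fun t ht =>
    ⟨by linarith [ht.1], by linarith [ht.2]⟩
  refine ⟨fun k t => C.mode k ⬝ᵥ (p (projIcc (-C.τ) T hle t) - C.equalState),
    fun k t => C.mode k ⬝ᵥ C.field (p t) (p (t - C.τ)) - (C.Φ₁ * C.eigval k *
      (C.mode k ⬝ᵥ (p (t - C.τ) - C.equalState)) - C.Φ₂ * C.eigval k *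
        (C.mode k ⬝ᵥ (p t - C.equalState))), fun k => ?_, hu, fun k t ht => ?_, fun t ht => ?_⟩
  · exact (continuous_const.dotProduct (hpc.sub continuous_const))
  · have hd := hp.2 t ht (hnear t (h1 t ht)) (hnear _ (h2 t ht))
    have hsum := HasDerivWithinAt.fun_sum (u := Finset.univ) fun i (_ : i ∈ Finset.univ) =>
      ((hasDerivWithinAt_pi.1 hd i).sub_const (C.equalState i)).const_mul (C.mode k i)
    simp only [hu k t (h1 t ht), hu k _ (h2 t ht), add_sub_cancel]
    exact hsum.congr (fun s hs => hu k s (h1 s hs)) (hu k t (h1 t ht))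
  · simp only [hu _ t (h1 t ht), hu _ _ (h2 t ht)]
    exact hR _ _ (hnear t (h1 t ht)) (hnear _ (h2 t ht))

/-- Exponential decay along solutions that stay near the equal-size state. -/
lemma exists_decay (hn : 2 ≤ n) (hX : ∀ l, ContDiffAt ℝ 1 (C.X l) C.share) (h1 : 0 ≤ C.Φ₁)
    (h12 : C.Φ₁ < C.Φ₂) :
    ∃ ρ > 0, ∃ Q > 0, ∃ σ > 0, ∀ T, 0 ≤ T → ∀ p : ℝ → Fin n → ℝ, C.SolvesNear ρ T p →
      (∀ t ∈ Icc (-C.τ) T, dist (p t) C.equalState ≤ ρ) →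
      (∀ t ∈ Icc (-C.τ) T, ∑ i, p t i = 1) →
      ∀ d, (∀ t ∈ Icc (-C.τ) 0, dist (p t) C.equalState ≤ d) →
        dist (p T) C.equalState ^ 2 ≤ Q * d ^ 2 * Real.exp (-(2 * σ * T)) := by
  have hτ := C.τ_pos
  obtain ⟨g, hg, hgap⟩ := exists_gap fun k => (C.Φ₂ - C.Φ₁) * C.eigval k
  set A' := C.Φ₁ * ∑ k, C.eigval k
  have hA' : 0 ≤ A' := mul_nonneg h1 (Finset.sum_nonneg fun k _ => C.eigval_nonneg k)
  have hAA' : ∀ k, C.Φ₁ * C.eigval k ≤ A' := fun k =>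
    mul_le_mul_of_nonneg_left (Finset.single_le_sum (fun k _ => C.eigval_nonneg k)
      (Finset.mem_univ k)) h1
  have hA : ∀ k, 0 ≤ C.Φ₁ * C.eigval k := fun k => mul_nonneg h1 (C.eigval_nonneg k)
  obtain ⟨κ, hκ, σ, hσ, hdamp⟩ := hasDerivWithinAt_dampedFunctional hτ hg hA'
  obtain ⟨ρ, hρ, hmodal⟩ := C.exists_modal_coordinates hn hX (mul_pos hκ hg)
  set q := 1 / 2 + (A' / 2 + κ) * C.τ + κ * C.τ ^ 2
  have hn0 : (0 : ℝ) < n := by positivity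
  refine ⟨ρ, hρ, 2 * n ^ 2 * q, by positivity, σ, hσ, fun T hT p hp hnear hsum d hd => ?_⟩
  obtain ⟨u, R, hu, hup, hder, hRu⟩ := hmodal T hT p hp hnear
  have hle : -C.τ ≤ T := by linarith
  have hd0 : 0 ≤ d := dist_nonneg.trans (hd 0 ⟨by linarith, le_rfl⟩)
  -- the modes of eigenvalue `0` are absent, because deviations have mean zero
  have hu0 : ∀ k, C.eigval k = 0 → ∀ t ∈ Icc (-C.τ) T, u k t = 0 := by
    intro k hk t ht
    rw [hup k t ht]
    refine C.mode_dotProduct_eq_zero hk ?_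
    simp only [Pi.sub_apply, Finset.sum_sub_distrib, hsum t ht, C.sum_equalState hn, sub_self]
  let N : Fin n → ℝ → ℝ := fun k => dampedFunctional C.τ (C.Φ₁ * C.eigval k) κ (u k)
  have hN : ∀ k, ∀ t ∈ Icc 0 T, ∃ N', HasDerivWithinAt (N k) N' (Icc 0 T) t ∧
      N' ≤ -(2 * σ) * N k t - κ * (u k t ^ 2 + u k (t - C.τ) ^ 2) + g⁻¹ * R k t ^ 2 := by
    intro k t ht
    by_cases hk : C.eigval k = 0
    · refine hdamp σ hσ le_rfl _ (C.Φ₁ * C.eigval k + g) (hA k) (hAA' k) (by linarith) _ _ t _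
        (hu k) ((hder k t ht).congr_deriv ?_)
      rw [hu0 k hk t ⟨by linarith [ht.1], ht.2⟩, hk]
      ring
    · refine hdamp σ hσ le_rfl _ (C.Φ₂ * C.eigval k) (hA k) (hAA' k) ?_ _ _ t _
        (hu k) ((hder k t ht).congr_deriv (by ring))
      have hpos : 0 < C.eigval k := lt_of_le_of_ne (C.eigval_nonneg k) (Ne.symm hk)
      rw [← sub_mul]
      exact hgap k (mul_pos (by linarith) hpos)
  have hgron := le_exp_mul_of_deriv_ge (V := fun t => -∑ k, N k t) (r := 2 * σ) hT (by
    intro t ht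
    choose N' hN' hN'le using fun k => hN k t ht
    refine ⟨-∑ k, N' k, (HasDerivWithinAt.fun_sum fun k _ => hN' k).neg, ?_⟩
    have hs : ∑ k, N' k ≤ ∑ k, (-(2 * σ) * N k t - κ * (u k t ^ 2 + u k (t - C.τ) ^ 2)
        + g⁻¹ * R k t ^ 2) := Finset.sum_le_sum fun k _ => hN'le k
    rw [Finset.sum_add_distrib, Finset.sum_sub_distrib, ← Finset.mul_sum, ← Finset.mul_sum,
      ← Finset.mul_sum] at hs
    have hr := mul_le_mul_of_nonneg_left (hRu t ht) (inv_pos.2 hg).le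
    rw [mul_comm κ g, mul_assoc g, inv_mul_cancel_left₀ hg.ne'] at hr
    linarith)
  have hlow : dist (p T) C.equalState ^ 2 / 2 ≤ ∑ k, N k T := by
    have h := Finset.sum_le_sum fun k (_ : k ∈ Finset.univ) =>
      half_sq_le_dampedFunctional hτ.le (hA k) hκ.le (u k) T
    rw [← Finset.sum_div, Finset.sum_congr rfl fun k _ => by rw [hup k T ⟨hle, le_rfl⟩],
      C.sum_sq_mode_dotProduct] at h
    refine le_trans ?_ h
    rw [dist_eq_norm]
    have := norm_sq_le_sum_sq (p T - C.equalState)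
    gcongr
  have hup0 : ∑ k, N k 0 ≤ n * (q * (n * d ^ 2)) := by
    have : ∀ k ∈ Finset.univ, N k 0 ≤ q * (n * d ^ 2) := by
      intro k _
      have h := dampedFunctional_le (t := 0) (S := √n * d) hτ.le (hA k) hκ.le (hu k) (by
        intro s hs
        rw [zero_sub] at hs
        rw [hup k s ⟨hs.1, hs.2.trans hT⟩]
        refine C.abs_mode_dotProduct_le ?_ k
        rw [← dist_eq_norm]
        exact hd s hs)
      rw [mul_pow, Real.sq_sqrt hn0.le] at h
      refine h.trans ?_
      have := hAA' k
      simp only [q]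
      gcongr
    simpa using Finset.sum_le_card_nsmul _ _ _ this
  have hexp : Real.exp (2 * σ * T) * Real.exp (-(2 * σ * T)) = 1 := by
    rw [← Real.exp_add]; simp
  have hmul : ∑ k, N k T ≤ Real.exp (-(2 * σ * T)) * ∑ k, N k 0 := by
    have h := mul_le_mul_of_nonneg_left hgron (Real.exp_pos (-(2 * σ * T))).le
    nlinarith
  calc dist (p T) C.equalState ^ 2 ≤ 2 * ∑ k, N k T := by linarith
    _ ≤ 2 * (Real.exp (-(2 * σ * T)) * (n * (q * (n * d ^ 2)))) := by
      gcongr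
      exact hmul.trans (by gcongr)
    _ = _ := by ring

/-- Solutions that start near the equal-size state stay near it and converge to it. -/
lemma exists_stay_near (hn : 2 ≤ n) (hX : ∀ l, ContDiffAt ℝ 1 (C.X l) C.share) (h1 : 0 ≤ C.Φ₁)
    (h12 : C.Φ₁ < C.Φ₂) :
    ∃ ρ > 0, ∃ Q > 0, ∃ σ > 0, ∀ ε, 0 < ε → ε ≤ ρ → ∃ δ > 0, ∀ T, 0 ≤ T →
      ∀ p : ℝ → Fin n → ℝ, C.SolvesNear ε T p → (∀ t ∈ Icc (-C.τ) T, ∑ i, p t i = 1) →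
      (∀ t ∈ Icc (-C.τ) 0, dist (p t) C.equalState < δ) →
      (∀ t ∈ Icc (-C.τ) T, dist (p t) C.equalState < ε) ∧
        dist (p T) C.equalState ^ 2 ≤ Q * δ ^ 2 * Real.exp (-(2 * σ * T)) := by
  obtain ⟨ρ, hρ, Q, hQ, σ, hσ, hdecay⟩ := C.exists_decay hn hX h1 h12
  have hτ := C.τ_pos
  refine ⟨ρ, hρ, Q, hQ, σ, hσ, fun ε hε hερ => ⟨ε / √(Q + 1), by positivity, ?_⟩⟩
  set δ := ε / √(Q + 1)
  have hQδ : Q * δ ^ 2 < ε ^ 2 := by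
    rw [div_pow, Real.sq_sqrt (by positivity), ← mul_div_assoc, div_lt_iff₀ (by positivity)]
    nlinarith [sq_pos_of_pos hε]
  have hδε : δ ≤ ε := div_le_self hε.le (Real.one_le_sqrt.2 (by linarith))
  intro T hT p hp hsum hhist
  have hdec : ∀ s ∈ Icc 0 T, (∀ t ∈ Icc (-C.τ) s, dist (p t) C.equalState ≤ ε) →
      dist (p s) C.equalState ^ 2 ≤ Q * δ ^ 2 * Real.exp (-(2 * σ * s)) := by
    intro s hs hnear
    have hp' : C.SolvesNear ρ s p := by
      refine ⟨(hp.mono le_rfl hs.2).1, fun t ht _ _ => (hp.mono le_rfl hs.2).2 t ht ?_ ?_⟩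
      · exact hnear t ⟨by linarith [ht.1], ht.2⟩
      · exact hnear _ ⟨by linarith [ht.1], by linarith [ht.2]⟩
    exact hdecay s hs.1 p hp' (fun t ht => (hnear t ht).trans hερ)
      (fun t ht => hsum t ⟨ht.1, ht.2.trans hs.2⟩) δ (fun t ht => (hhist t ht).le)
  have hstay : ∀ t ∈ Icc (-C.τ) T, dist (p t) C.equalState < ε := by
    by_contra! hcon
    obtain ⟨t₀, ht₀, hfar⟩ := hcon
    have h0 : 0 ≤ t₀ := by
      by_contra! h
      linarith [hhist t₀ ⟨ht₀.1, h.le⟩]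
    obtain ⟨s, hs, hs1, hs2⟩ := exists_first_exit (a := -C.τ) (b := 0) (c := t₀) (by linarith)
      (hp.continuousOn_dist.mono (Icc_subset_Icc_right ht₀.2))
      (fun t ht => (hhist t ht).trans_le hδε) h0 hfar
    have h2 := hdec s ⟨hs.1, hs.2.trans ht₀.2⟩ hs2
    have h3 : Real.exp (-(2 * σ * s)) ≤ 1 := by
      rw [Real.exp_le_one_iff, neg_nonpos]
      exact mul_nonneg (by positivity) hs.1
    have h4 : Q * δ ^ 2 * Real.exp (-(2 * σ * s)) ≤ Q * δ ^ 2 :=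
      mul_le_of_le_one_right (by positivity) h3
    rw [hs1] at h2
    linarith
  exact ⟨hstay, hdec T ⟨hT, le_rfl⟩ fun t ht => (hstay t ht).le⟩

theorem isAsymptoticallyStable_equalState (hn : 2 ≤ n)
    (hX : ∀ l, ContDiffAt ℝ 1 (C.X l) C.share) (h1 : 0 ≤ C.Φ₁) (h12 : C.Φ₁ < C.Φ₂) :
    C.IsAsymptoticallyStable C.equalState := by
  obtain ⟨ρ, hρ, Q, hQ, σ, hσ, hstay⟩ := C.exists_stay_near hn hX h1 h12
  obtain ⟨ρ', hρ', hex⟩ := C.exists_local_solution hn hX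
  have hs := C.share_pos hn
  refine ⟨fun ε hε => ?_, ?_⟩
  · set ε' := min ε (min ρ (min ρ' C.share))
    have hε' : 0 < ε' := by positivity
    have h2 : ε' ≤ ρ := (min_le_right _ _).trans (min_le_left _ _)
    have h3 : ε' ≤ ρ' := (min_le_right _ _).trans ((min_le_right _ _).trans (min_le_left _ _))
    have h4 : ε' ≤ C.share := (min_le_right _ _).trans ((min_le_right _ _).trans (min_le_right _ _))
    obtain ⟨δ, hδ, hnear⟩ := hstay ε' hε' h2
    refine ⟨δ, hδ, fun φ hφ => ⟨?_, fun T hT p hp t ht => ?_⟩⟩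
    · obtain ⟨p, hp0, hp⟩ := hex φ hφ.1
      refine ⟨p, fun T hT => ?_⟩
      have hsolve : C.SolvesNear ε' T p :=
        SolvesNear.mono (C := C) (ρ := ρ') ⟨(hp T hT).1, (hp T hT).2.2⟩ h3 le_rfl
      have := (hnear T hT p hsolve (hp T hT).2.1 fun t ht => by
        rw [hp0 t ht]; exact hφ.2 t ht).1
      exact hsolve.isSolutionOn hp0 (hp T hT).2.1 h4 fun t ht => (this t ht).le
    · have := (hnear T hT p (hp.solvesNear ε') (fun t ht => (hp.mem_simplex t ht).2) fun t ht => by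
        rw [hp.history t ht]; exact hφ.2 t ht).1 t ⟨by linarith [ht.1, C.τ_pos], ht.2⟩
      exact this.trans_le (min_le_left _ _)
  · obtain ⟨δ, hδ, hnear⟩ := hstay ρ hρ le_rfl
    refine ⟨δ, hδ, fun φ hφ p hp => ?_⟩
    have hdec : ∀ T, 0 ≤ T →
        dist (p T) C.equalState ^ 2 ≤ Q * δ ^ 2 * Real.exp (-(2 * σ * T)) := fun T hT =>
      (hnear T hT p ((hp T hT).solvesNear ρ) (fun t ht => ((hp T hT).mem_simplex t ht).2)
        fun t ht => by rw [(hp T hT).history t ht]; exact hφ.2 t ht).2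
    have hlim : Tendsto (fun T => Q * δ ^ 2 * Real.exp (-(2 * σ * T))) atTop (𝓝 0) := by
      have : Tendsto (fun T : ℝ => Real.exp (-(2 * σ * T))) atTop (𝓝 0) :=
        Real.tendsto_exp_neg_atTop_nhds_zero.comp
          (tendsto_id.const_mul_atTop (by positivity : 0 < 2 * σ))
      simpa using this.const_mul (Q * δ ^ 2)
    have hsq : Tendsto (fun T => dist (p T) C.equalState ^ 2) atTop (𝓝 0) :=
      squeeze_zero' (Eventually.of_forall fun T => sq_nonneg _)
        ((eventually_ge_atTop 0).mono hdec) hlim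
    rw [tendsto_iff_dist_tendsto_zero]
    have h := (Real.continuous_sqrt.tendsto 0).comp hsq
    rw [Real.sqrt_zero] at h
    refine h.congr fun T => ?_
    simp [Real.sqrt_sq dist_nonneg]

end CityModel

/-! ### Instability -/

lemma resonantFunctional_congr {τ A K ε κ t : ℝ} (hτ : 0 ≤ τ) {w w' : ℝ → ℝ}
    (h : ∀ s ∈ Icc (t - τ) t, w s = w' s) :
    resonantFunctional τ A K ε κ w t = resonantFunctional τ A K ε κ w' t := by
  have h' : ∀ s ∈ uIcc (t - τ) t, w s = w' s := by rwa [uIcc_of_le (by linarith)]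
  unfold resonantFunctional windowIntegral rampIntegral
  rw [h t ⟨by linarith, le_rfl⟩,
    intervalIntegral.integral_congr (f := w) (g := w') h',
    intervalIntegral.integral_congr (f := fun s => w s ^ 2) (g := fun s => w' s ^ 2)
      fun s hs => by simp only [h' s hs],
    intervalIntegral.integral_congr (f := fun s => (s - (t - τ)) * w s)
      (g := fun s => (s - (t - τ)) * w' s) fun s hs => by simp only [h' s hs],
    intervalIntegral.integral_congr (f := fun s => (s - (t - τ)) * w s ^ 2)
      (g := fun s => (s - (t - τ)) * w' s ^ 2) fun s hs => by simp only [h' s hs]]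

lemma dampedFunctional_eq_zero {τ A κ t : ℝ} (hτ : 0 ≤ τ) {w : ℝ → ℝ}
    (h : ∀ s ∈ Icc (t - τ) t, w s = 0) : dampedFunctional τ A κ w t = 0 := by
  have h' : ∀ s ∈ uIcc (t - τ) t, w s = 0 := by rwa [uIcc_of_le (by linarith)]
  unfold dampedFunctional windowIntegral rampIntegral
  rw [h t ⟨by linarith, le_rfl⟩,
    intervalIntegral.integral_congr (f := fun s => w s ^ 2) (g := fun _ => 0)
      fun s hs => by simp [h' s hs],
    intervalIntegral.integral_congr (f := fun s => (s - (t - τ)) * w s ^ 2)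
      (g := fun _ => 0) fun s hs => by simp [h' s hs]]
  simp

/-- If `b < a`, the scalar equation `u' = μ (a u(t - τ) - b u)` has an exponentially growing
solution. -/
lemma exists_growth_rate {a b τ μ : ℝ} (ha : 0 ≤ a) (hab : b < a) (hτ : 0 ≤ τ) (hμ : 0 < μ) :
    ∃ r > 0, r = μ * (a * Real.exp (-(r * τ)) - b) := by
  set f : ℝ → ℝ := fun r => r - μ * (a * Real.exp (-(r * τ)) - b) with hf
  have hfc : Continuous f := by fun_prop
  have hΛ : 0 < μ * (a - b) := mul_pos hμ (by linarith)
  have hf0 : f 0 < 0 := by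
    simp only [hf, zero_mul, neg_zero, Real.exp_zero, mul_one, zero_sub]
    linarith
  have hfΛ : 0 ≤ f (μ * (a - b)) := by
    have h1 : Real.exp (-(μ * (a - b) * τ)) ≤ 1 := by
      rw [Real.exp_le_one_iff, neg_nonpos]; positivity
    have h2 : μ * (a * Real.exp (-(μ * (a - b) * τ)) - b) ≤ μ * (a * 1 - b) := by gcongr
    simp only [hf]
    linarith
  obtain ⟨r, hr, hr0⟩ := intermediate_value_Icc hΛ.le hfc.continuousOn ⟨hf0.le, hfΛ⟩
  refine ⟨r, lt_of_le_of_ne hr.1 ?_, by simp only [hf] at hr0; linarith⟩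
  rintro rfl
  exact hf0.ne hr0

namespace CityModel

open Matrix

variable {n m : ℕ} (C : CityModel n m)

/-- Along a suitable direction `v`, solutions with exponential histories of arbitrarily small size
leave a fixed neighbourhood of the equal-size state. -/
lemma exists_escape (hn : 2 ≤ n) (hX : ∀ l, ContDiffAt ℝ 1 (C.X l) C.share) (h1 : 0 ≤ C.Φ₁)
    (h21 : C.Φ₂ < C.Φ₁) :
    ∃ ρ > 0, ∃ r > 0, ∃ v : Fin n → ℝ, ∑ i, v i = 0 ∧ ∀ s > 0, ∃ T, 0 ≤ T ∧
      ∀ p : ℝ → Fin n → ℝ, C.SolvesNear ρ T p →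
        (∀ t ∈ Icc (-C.τ) 0, p t = C.equalState + (s * Real.exp (r * t)) • v) →
        ∃ t ∈ Icc (-C.τ) T, ρ < dist (p t) C.equalState := by
  have hτ := C.τ_pos
  have hn0 : (0 : ℝ) < n := by positivity
  obtain ⟨k₁, hk₁⟩ := C.exists_eigval_pos hn
  -- the top eigenvalue `μ` determines the largest growth rate `r`
  obtain ⟨k₀, -, hmax⟩ := Finset.exists_max_image Finset.univ C.eigval ⟨k₁, Finset.mem_univ _⟩
  set μ := C.eigval k₀ with hμdef
  have hμ : 0 < μ := hk₁.trans_le (hmax k₁ (Finset.mem_univ _))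
  obtain ⟨r, hr, hreq⟩ := exists_growth_rate h1 h21 hτ.le hμ
  set e := Real.exp (-(r * C.τ)) with he
  have he0 : 0 < e := Real.exp_pos _
  have he1 : e ≤ 1 := by rw [he, Real.exp_le_one_iff, neg_nonpos]; positivity
  obtain ⟨g, hg, hgap⟩ := exists_gap fun k => C.Φ₂ * C.eigval k + r - C.Φ₁ * C.eigval k * e
  have hA0 : ∀ k, 0 ≤ C.Φ₁ * C.eigval k * e := fun k =>
    mul_nonneg (mul_nonneg h1 (C.eigval_nonneg k)) he0.le
  have hAle : ∀ k, C.Φ₁ * C.eigval k * e ≤ C.Φ₁ * μ * e := fun k => by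
    have := hmax k (Finset.mem_univ k)
    gcongr
  have hgap' : ∀ k, C.eigval k ≠ μ → g ≤ C.Φ₂ * C.eigval k + r - C.Φ₁ * C.eigval k * e := by
    intro k hk
    refine hgap k ?_
    have hlt : C.eigval k < μ := lt_of_le_of_ne (hmax k (Finset.mem_univ k)) hk
    have hpos : 0 < C.Φ₁ * e - C.Φ₂ := by
      rw [hreq] at hr
      exact pos_of_mul_pos_right hr hμ.le
    have : C.eigval k * (C.Φ₁ * e - C.Φ₂) < μ * (C.Φ₁ * e - C.Φ₂) :=
      mul_lt_mul_of_pos_right hlt hpos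
    linarith
  obtain ⟨κ, hκ, σ₁, hσ₁, hdamp⟩ := hasDerivWithinAt_dampedFunctional hτ hg (hA0 k₀)
  obtain ⟨K, hK, ε, hε, σ₂, hσ₂, hres⟩ := hasDerivWithinAt_resonantFunctional hτ (hA0 k₀)
  rw [← hμdef] at hdamp hK hres
  set A := C.Φ₁ * μ * e with hA
  have hA0' : 0 ≤ A := hA0 k₀
  have hK0 : 0 ≤ K := le_trans (by positivity) hK
  set σ := min σ₁ (min σ₂ (r / 2)) with hσdef
  have hσ : 0 < σ := by positivity
  have hσ1 : σ ≤ σ₁ := min_le_left _ _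
  have hσ2 : σ ≤ σ₂ := (min_le_right _ _).trans (min_le_left _ _)
  have hσr : σ ≤ r / 2 := (min_le_right _ _).trans (min_le_right _ _)
  obtain ⟨hσ_one, D, hD, hres⟩ := hres σ hσ hσ2
  have hdamp := hdamp σ hσ hσ1
  set c := min σ κ
  have hc : 0 < c := by positivity
  set B := D + g⁻¹
  have hB : 0 < B := by positivity
  obtain ⟨ρ, hρ, hmodal⟩ := C.exists_modal_coordinates hn hX (div_pos hc hB)
  have hv : ∑ i, C.mode k₀ i = 0 := C.sum_mode hμ.ne'
  refine ⟨ρ, hρ, r, hr, C.mode k₀, hv, fun s hs => ?_⟩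
  -- at time `T` the lower and upper bounds for the functional are incompatible
  set Z := n * (K * (1 + A * C.τ) ^ 2 * (n * (Real.exp (r * C.τ) * ρ) ^ 2))
  obtain ⟨T, hT, hTlt⟩ : ∃ T, 0 ≤ T ∧ Z * Real.exp (-(r * T)) < s ^ 2 / 2 := by
    have hlim : Tendsto (fun T => Z * Real.exp (-(r * T))) atTop (𝓝 0) := by
      have : Tendsto (fun T : ℝ => Real.exp (-(r * T))) atTop (𝓝 0) :=
        Real.tendsto_exp_neg_atTop_nhds_zero.comp (tendsto_id.const_mul_atTop hr)
      simpa using this.const_mul Z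
    exact ((eventually_ge_atTop 0).and (hlim.eventually_lt_const (by positivity))).exists
  refine ⟨T, hT, fun p hp hhist => ?_⟩
  by_contra! hnear
  obtain ⟨u, R, hu, hup, hder, hRu⟩ := hmodal T hT p hp hnear
  have hle : -C.τ ≤ T := by linarith
  let w : Fin n → ℝ → ℝ := fun k t => Real.exp (-(r * t)) * u k t
  have hw : ∀ k, Continuous (w k) := fun k => by have := hu k; fun_prop
  have hwτ : ∀ k t, Real.exp (-(r * t)) * u k (t - C.τ) = e * w k (t - C.τ) := by
    intro k t
    simp only [w, he]
    rw [← mul_assoc, ← Real.exp_add]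
    congr 2
    ring
  have hwder : ∀ k, ∀ t ∈ Icc 0 T, HasDerivWithinAt (w k)
      (-(C.Φ₂ * C.eigval k + r) * w k t + C.Φ₁ * C.eigval k * e * w k (t - C.τ)
        + Real.exp (-(r * t)) * R k t) (Icc 0 T) t := by
    intro k t ht
    have hE : HasDerivWithinAt (fun t => Real.exp (-(r * t))) (Real.exp (-(r * t)) * -r)
        (Icc 0 T) t := by
      have := ((hasDerivAt_id t).const_mul r).neg.exp.hasDerivWithinAt (s := Icc 0 T)
      simpa using this
    refine (hE.mul (hder k t ht)).congr_deriv ?_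
    rw [mul_assoc (C.Φ₁ * C.eigval k) e, ← hwτ]
    simp only [w]
    ring
  have hwR : ∀ t ∈ Icc 0 T, B * ∑ k, (Real.exp (-(r * t)) * R k t) ^ 2 ≤
      c * ∑ k, (w k t ^ 2 + w k (t - C.τ) ^ 2) := by
    intro t ht
    have h2 := mul_le_mul_of_nonneg_left (hRu t ht)
      (by positivity : 0 ≤ B * Real.exp (-(r * t)) ^ 2)
    have e1 : B * ∑ k, (Real.exp (-(r * t)) * R k t) ^ 2 =
        B * Real.exp (-(r * t)) ^ 2 * ∑ k, R k t ^ 2 := by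
      simp only [mul_pow, ← Finset.mul_sum]
      ring
    have e2 : B * Real.exp (-(r * t)) ^ 2 * (c / B * ∑ k, (u k t ^ 2 + u k (t - C.τ) ^ 2)) =
        c * ∑ k, (w k t ^ 2 + (e * w k (t - C.τ)) ^ 2) := by
      simp only [← hwτ, w, mul_pow, ← mul_add, ← Finset.mul_sum]
      field_simp
    rw [e1]
    refine h2.trans ?_
    rw [e2]
    refine mul_le_mul_of_nonneg_left (Finset.sum_le_sum fun k _ => ?_) hc.le
    rw [mul_pow]
    have := mul_le_of_le_one_left (sq_nonneg (w k (t - C.τ)))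
      (pow_le_one₀ he0.le he1 : e ^ 2 ≤ 1)
    linarith
  let V : Fin n → ℝ → ℝ := fun k t => if C.eigval k = μ then
    resonantFunctional C.τ A K ε σ (w k) t
    else -dampedFunctional C.τ (C.Φ₁ * C.eigval k * e) κ (w k) t
  have hV : ∀ k, ∀ t ∈ Icc 0 T, ∃ V', HasDerivWithinAt (V k) V' (Icc 0 T) t ∧
      -(2 * σ) * V k t + c * (w k t ^ 2 + w k (t - C.τ) ^ 2)
        - B * (Real.exp (-(r * t)) * R k t) ^ 2 ≤ V' := by
    intro k t ht
    have hq : 0 ≤ w k t ^ 2 + w k (t - C.τ) ^ 2 := by positivity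
    by_cases hk : C.eigval k = μ
    · have hVk : V k = resonantFunctional C.τ A K ε σ (w k) := funext fun t => if_pos hk
      obtain ⟨V', hV', hle'⟩ := hres (w k) (Icc 0 T) t _ (hw k)
        ((hwder k t ht).congr_deriv (by
          have : C.Φ₂ * μ + r = A := by rw [hA]; linarith
          rw [hk, this, ← hA]))
      rw [hVk]
      refine ⟨V', hV', le_trans ?_ hle'⟩
      have h3 : c ≤ σ := min_le_left _ _
      have h4 : D ≤ B := le_add_of_nonneg_right (inv_pos.2 hg).le
      gcongr
    · have hVk : V k = fun t => -dampedFunctional C.τ (C.Φ₁ * C.eigval k * e) κ (w k) t :=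
        funext fun t => if_neg hk
      obtain ⟨N', hN', hle'⟩ := hdamp _ _ (hA0 k) (hAle k) (hgap' k hk) (w k) (Icc 0 T) t _ (hw k)
        (hwder k t ht)
      rw [hVk]
      refine ⟨-N', hN'.neg, ?_⟩
      have h3 : c * (w k t ^ 2 + w k (t - C.τ) ^ 2) ≤ κ * (w k t ^ 2 + w k (t - C.τ) ^ 2) := by
        gcongr
        exact min_le_right _ _
      have h4 : g⁻¹ * (Real.exp (-(r * t)) * R k t) ^ 2 ≤
          B * (Real.exp (-(r * t)) * R k t) ^ 2 := by
        gcongr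
        exact le_add_of_nonneg_left hD
      linarith
  have hgron := le_exp_mul_of_deriv_ge (V := fun t => ∑ k, V k t) (r := 2 * σ) hT (by
    intro t ht
    choose V' hV' hV'le using fun k => hV k t ht
    refine ⟨∑ k, V' k, HasDerivWithinAt.fun_sum fun k _ => hV' k, ?_⟩
    have hsum : ∑ k, (-(2 * σ) * V k t + c * (w k t ^ 2 + w k (t - C.τ) ^ 2)
        - B * (Real.exp (-(r * t)) * R k t) ^ 2) ≤ ∑ k, V' k :=
      Finset.sum_le_sum fun k _ => hV'le k
    rw [Finset.sum_sub_distrib, Finset.sum_add_distrib, ← Finset.mul_sum, ← Finset.mul_sum,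
      ← Finset.mul_sum] at hsum
    have := hwR t ht
    linarith)
  -- after rescaling, the history is constant and lies in the top mode
  have hw0 : ∀ k, ∀ t ∈ Icc (0 - C.τ) 0, w k t = if k = k₀ then s else 0 := by
    intro k t ht
    rw [zero_sub] at ht
    simp only [w]
    rw [hup k t ⟨ht.1, ht.2.trans hT⟩, hhist t ht, add_sub_cancel_left, dotProduct_smul,
      C.mode_dotProduct_mode, smul_eq_mul, mul_comm s, ← mul_assoc, ← mul_assoc, ← Real.exp_add]
    simp
  have hlow : s ^ 2 / 2 ≤ ∑ k, V k 0 := by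
    have hV0 : ∀ k, V k 0 = if k = k₀ then
        (K * (1 + A * C.τ) ^ 2 - 1 / 2 - (A / 2 + σ) * C.τ) * s ^ 2 else 0 := by
      intro k
      by_cases hk : C.eigval k = μ
      · simp only [V]
        rw [if_pos hk, resonantFunctional_congr hτ.le (hw0 k), resonantFunctional_const]
        split_ifs <;> simp
      · have hk' : k ≠ k₀ := by rintro rfl; exact hk rfl
        simp only [V]
        rw [if_neg hk, if_neg hk', dampedFunctional_eq_zero hτ.le fun t ht => by
          rw [hw0 k t ht, if_neg hk'], neg_zero]
    simp only [hV0, Finset.sum_ite_eq', Finset.mem_univ, if_true]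
    have h3 : K * 1 ≤ K * (1 + A * C.τ) ^ 2 := by
      have : 0 ≤ A * C.τ := by positivity
      gcongr
      exact one_le_pow₀ (by linarith)
    have h4 : (A / 2 + σ) * C.τ ≤ (A / 2 + 1) * C.τ := by gcongr
    have h5 : 1 / 2 ≤ K * (1 + A * C.τ) ^ 2 - 1 / 2 - (A / 2 + σ) * C.τ := by linarith
    have := mul_le_mul_of_nonneg_right h5 (sq_nonneg s)
    linarith
  have hhigh : ∑ k, V k T ≤ Z * Real.exp (-(r * T)) ^ 2 := by
    have hS : ∀ k, ∀ t ∈ Icc (T - C.τ) T,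
        |w k t| ≤ √n * (Real.exp (r * C.τ) * ρ * Real.exp (-(r * T))) := by
      intro k t ht
      have ht' : t ∈ Icc (-C.τ) T := ⟨by linarith [ht.1], ht.2⟩
      simp only [w]
      rw [abs_mul, Real.abs_exp, hup k t ht']
      have h2 := C.abs_mode_dotProduct_le (x := p t - C.equalState) (d := ρ)
        (by rw [← dist_eq_norm]; exact hnear t ht') k
      have h3 : Real.exp (-(r * t)) ≤ Real.exp (r * C.τ) * Real.exp (-(r * T)) := by
        rw [← Real.exp_add, Real.exp_le_exp]
        nlinarith [ht.1]
      calc _ ≤ (Real.exp (r * C.τ) * Real.exp (-(r * T))) * (√n * ρ) := by gcongr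
        _ = _ := by ring
    have hVk : ∀ k ∈ Finset.univ, V k T ≤ K * (1 + A * C.τ) ^ 2 *
        (√n * (Real.exp (r * C.τ) * ρ * Real.exp (-(r * T)))) ^ 2 := by
      intro k _
      simp only [V]
      split_ifs with hk
      · exact resonantFunctional_le hτ.le hA0' hK0 hε.le hσ.le (hw k) (hS k)
      · have h2 := half_sq_le_dampedFunctional hτ.le (hA0 k) hκ.le (w k) T
        refine le_trans ?_ (by positivity : (0 : ℝ) ≤ _)
        linarith [sq_nonneg (w k T)]
    have := Finset.sum_le_card_nsmul _ _ _ hVk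
    rw [Finset.card_univ, Fintype.card_fin, nsmul_eq_mul, mul_pow, Real.sq_sqrt hn0.le] at this
    refine this.trans (le_of_eq ?_)
    simp only [Z]
    ring
  have hfin : Real.exp (2 * σ * T) * (Z * Real.exp (-(r * T)) ^ 2) ≤
      Z * Real.exp (-(r * T)) := by
    have h2 : Real.exp (2 * σ * T) * Real.exp (-(r * T)) ≤ 1 := by
      rw [← Real.exp_add, Real.exp_le_one_iff]
      nlinarith
    have hZ : 0 ≤ Z * Real.exp (-(r * T)) := by positivity
    calc _ = (Real.exp (2 * σ * T) * Real.exp (-(r * T))) * (Z * Real.exp (-(r * T))) := by ring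
      _ ≤ 1 * (Z * Real.exp (-(r * T))) := by gcongr
      _ = _ := one_mul _
  have := mul_le_mul_of_nonneg_left hhigh (Real.exp_pos (2 * σ * T)).le
  linarith

theorem isUnstable_equalState (hn : 2 ≤ n) (hX : ∀ l, ContDiffAt ℝ 1 (C.X l) C.share)
    (h1 : 0 ≤ C.Φ₁) (h21 : C.Φ₂ < C.Φ₁) : C.IsUnstable C.equalState := by
  obtain ⟨ρ₁, hρ₁, r, hr, v, hv, hesc⟩ := C.exists_escape hn hX h1 h21
  obtain ⟨ρ₂, hρ₂, hex⟩ := C.exists_local_solution hn hX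
  have hs := C.share_pos hn
  have hτ := C.τ_pos
  set ρ := min ρ₁ (min ρ₂ C.share)
  have hρ : 0 < ρ := by positivity
  have hρ1 : ρ ≤ ρ₁ := min_le_left _ _
  have hρ2 : ρ ≤ ρ₂ := (min_le_right _ _).trans (min_le_left _ _)
  have hρs : ρ ≤ C.share := (min_le_right _ _).trans (min_le_right _ _)
  refine ⟨ρ, hρ, fun δ hδ => ?_⟩
  set s := min δ ρ / (‖v‖ + 1)
  have hs0 : 0 < s := by positivity
  have hdist : ∀ t ∈ Icc (-C.τ) 0,
      dist (C.equalState + (s * Real.exp (r * t)) • v) C.equalState < min δ ρ := by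
    intro t ht
    rw [dist_eq_norm, add_sub_cancel_left, norm_smul, Real.norm_eq_abs, abs_of_pos (by positivity)]
    have h2 : Real.exp (r * t) ≤ 1 := by
      rw [Real.exp_le_one_iff]
      exact mul_nonpos_of_nonneg_of_nonpos hr.le ht.2
    calc s * Real.exp (r * t) * ‖v‖ ≤ s * 1 * ‖v‖ := by gcongr
      _ < s * (‖v‖ + 1) := by linarith
      _ = min δ ρ := div_mul_cancel₀ _ (by positivity)
  set φ : ℝ → Fin n → ℝ := fun t => C.equalState + (s * Real.exp (r * t)) • v
  have hφ : C.IsHistory φ := by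
    refine ⟨Continuous.continuousOn (by fun_prop), fun t ht => ?_⟩
    refine C.mem_stdSimplex_of_dist_le
      ((hdist t ht).le.trans ((min_le_right _ _).trans hρs)) ?_
    simp only [φ, Pi.add_apply, Pi.smul_apply, smul_eq_mul, Finset.sum_add_distrib,
      ← Finset.mul_sum, hv, C.sum_equalState hn]
    simp
  refine ⟨φ, ⟨hφ, fun t ht => (hdist t ht).trans_le (min_le_left _ _)⟩, ?_⟩
  obtain ⟨p, hp0, hp⟩ := hex φ hφ
  obtain ⟨T, hT, hfar⟩ := hesc s hs0
  have hsolve : C.SolvesNear ρ₂ T p := ⟨(hp T hT).1, (hp T hT).2.2⟩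
  have hnear0 : ∀ t ∈ Icc (-C.τ) 0, dist (p t) C.equalState < ρ := fun t ht => by
    rw [hp0 t ht]
    exact (hdist t ht).trans_le (min_le_right _ _)
  obtain ⟨t₀, ht₀, hfar₀⟩ : ∃ t ∈ Icc (-C.τ) T, ρ ≤ dist (p t) C.equalState := by
    by_contra! hcon
    have hp' : C.SolvesNear ρ₁ T p := ⟨hsolve.1, fun t ht _ _ => hsolve.2 t ht
      ((hcon t ⟨by linarith [ht.1], ht.2⟩).le.trans hρ2)
      ((hcon _ ⟨by linarith [ht.1], by linarith [ht.2]⟩).le.trans hρ2)⟩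
    obtain ⟨t, ht, h⟩ := hfar p hp' hp0
    linarith [hcon t ht]
  have h0 : 0 ≤ t₀ := by
    by_contra! h
    linarith [hnear0 t₀ ⟨ht₀.1, h.le⟩]
  obtain ⟨t₁, ht₁, hexit, hnear⟩ := exists_first_exit (a := -C.τ) (b := 0) (c := t₀) (by linarith)
    (hsolve.continuousOn_dist.mono (Icc_subset_Icc_right ht₀.2)) hnear0 h0 hfar₀
  have ht₁T : t₁ ≤ T := ht₁.2.trans ht₀.2
  exact ⟨t₁, ht₁.1, p, (hsolve.mono hρ2 ht₁T).isSolutionOn hp0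
    (fun t ht => (hp T hT).2.1 t ⟨ht.1, ht.2.trans ht₁T⟩) hρs hnear, hexit.ge⟩

end CityModel

/-! ### Allocation rules -/

namespace CityModel

variable {n m : ℕ} (C : CityModel n m)

lemma margin_nonneg (hn : 2 ≤ n) (l : Fin m) : 0 ≤ C.margin l := by
  have hY := C.need_pos (C.share_pos hn) l
  have hX := C.X_nonneg l _ (C.share_mem_Icc hn)
  have hα := C.α_nonneg l
  unfold margin
  positivity

/-- The factor `share` left over from `share ^ 2` turns the weights of `Φ₂` into those of the
average exponent. -/
lemma Φ₂_eq (hn : 2 ≤ n) :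
    C.Φ₂ = C.share * ∑ l, C.margin l * C.X l C.share * C.β l := by
  have hs := (C.share_pos hn).ne'
  unfold Φ₂
  rw [Finset.mul_sum, Finset.mul_sum]
  refine Finset.sum_congr rfl fun l _ => ?_
  field_simp

lemma Φ₁_eq_of_proportional (hn : 2 ≤ n)
    (h : ∀ l, ∃ γ : ℝ, 0 < γ ∧ ∀ q ∈ Icc (0 : ℝ) 1, C.X l q = γ * q) :
    C.Φ₁ = C.share * ∑ l, C.margin l * C.X l C.share := by
  have hs := (C.share_pos hn).ne'
  unfold Φ₁
  rw [Finset.mul_sum, Finset.mul_sum]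
  refine Finset.sum_congr rfl fun l _ => ?_
  obtain ⟨γ, -, hγ⟩ := h l
  have hd : deriv (C.X l) C.share = γ := by
    have he : C.X l =ᶠ[𝓝 C.share] fun q => γ * q := by
      filter_upwards [Icc_mem_nhds (C.share_pos hn) (C.share_lt_one hn)] with q hq using hγ q hq
    rw [he.deriv_eq]
    simp
  rw [hd, hγ _ (C.share_mem_Icc hn)]
  ring

lemma sum_margin_pos_of_proportional (hn : 2 ≤ n)
    (h : ∀ l, ∃ γ : ℝ, 0 < γ ∧ ∀ q ∈ Icc (0 : ℝ) 1, C.X l q = γ * q) :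
    0 < ∑ l, C.margin l * C.X l C.share := by
  have hs := C.share_pos hn
  have hXpos : ∀ l, 0 < C.X l C.share := fun l => by
    obtain ⟨γ, hγ0, hγ⟩ := h l
    rw [hγ _ (C.share_mem_Icc hn)]
    positivity
  obtain ⟨l, -, hl⟩ : ∃ l ∈ Finset.univ, 0 < C.α l := by
    refine (Finset.sum_pos_iff_of_nonneg fun l _ => C.α_nonneg l).1 ?_
    rw [C.α_sum]
    exact one_pos
  refine Finset.sum_pos' (fun l _ => mul_nonneg (C.margin_nonneg hn l) (hXpos l).le)
    ⟨l, Finset.mem_univ l, mul_pos ?_ (hXpos l)⟩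
  have hY := C.need_pos hs l
  have hX := hXpos l
  unfold margin
  positivity

/-- For a concave nonnegative allocation rule, the marginal allocation at the equal-size state is at
most the allocation per share. -/
lemma deriv_mul_share_le (hn : 2 ≤ n) {l : Fin m} (hX : ContDiffAt ℝ 1 (C.X l) C.share)
    (hc : ConcaveOn ℝ (Icc (0 : ℝ) 1) (C.X l)) :
    deriv (C.X l) C.share * C.share ≤ C.X l C.share := by
  have hs := C.share_pos hn
  have h0 : (0 : ℝ) ∈ Icc (0 : ℝ) 1 := ⟨le_rfl, zero_le_one⟩
  have h := hc.le_slope_of_hasDerivAt h0 (C.share_mem_Icc hn) hs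
    (hX.differentiableAt one_ne_zero).hasDerivAt
  rw [slope_def_field, sub_zero, le_div_iff₀ hs] at h
  linarith [C.X_nonneg l 0 h0]

lemma Φ₁_le_of_concave (hn : 2 ≤ n) (hX : ∀ l, ContDiffAt ℝ 1 (C.X l) C.share)
    (hc : ∀ l, ConcaveOn ℝ (Icc (0 : ℝ) 1) (C.X l)) :
    C.Φ₁ ≤ C.share * ∑ l, C.margin l * C.X l C.share := by
  have hs := C.share_pos hn
  unfold Φ₁
  rw [sq, mul_assoc, Finset.mul_sum]
  refine mul_le_mul_of_nonneg_left (Finset.sum_le_sum fun l _ => ?_) hs.le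
  have := mul_le_mul_of_nonneg_left (C.deriv_mul_share_le hn (hX l) (hc l)) (C.margin_nonneg hn l)
  linarith

end CityModel

theorem mainTheorem3 {n m : ℕ} (hn : 2 ≤ n) (C : CityModel n m)
    (hX : ∀ l, ContDiffAt ℝ 1 (C.X l) C.share) (hΦ₁ : 0 ≤ C.Φ₁) :
    C.IsEquilibrium C.equalState ∧
    (C.Φ₁ < C.Φ₂ → C.IsAsymptoticallyStable C.equalState) ∧
    (C.Φ₂ < C.Φ₁ → C.IsUnstable C.equalState) ∧
    (C.Φ₁ < C.Φ₂ → ∀ z : ℂ, C.charFun z = 0 → z = 0 ∨ z.re < 0) ∧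
    ((∀ l, ∃ γ : ℝ, 0 < γ ∧ ∀ q ∈ Set.Icc (0 : ℝ) 1, C.X l q = γ * q) →
      (1 < C.averageExponent → C.IsAsymptoticallyStable C.equalState) ∧
      (C.averageExponent < 1 → C.IsUnstable C.equalState)) ∧
    ((∀ l, ConcaveOn ℝ (Set.Icc (0 : ℝ) 1) (C.X l)) →
      1 < C.averageExponent → C.IsAsymptoticallyStable C.equalState) := by
  have hs := C.share_pos hn
  refine ⟨C.isEquilibrium_equalState hn, C.isAsymptoticallyStable_equalState hn hX hΦ₁,
    C.isUnstable_equalState hn hX hΦ₁, fun h z hz => C.charFun_roots hΦ₁ h hz,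
    fun hprop => ?_, fun hconc havg => ?_⟩
  · have hΦ := C.Φ₁_eq_of_proportional hn hprop
    have hpos := C.sum_margin_pos_of_proportional hn hprop
    refine ⟨fun havg => C.isAsymptoticallyStable_equalState hn hX hΦ₁ ?_,
      fun havg => C.isUnstable_equalState hn hX hΦ₁ ?_⟩
    · rw [hΦ, C.Φ₂_eq hn]
      rw [CityModel.averageExponent, one_lt_div hpos] at havg
      gcongr
    · rw [hΦ, C.Φ₂_eq hn]
      rw [CityModel.averageExponent, div_lt_one hpos] at havg
      gcongr
  · refine C.isAsymptoticallyStable_equalState hn hX hΦ₁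
      ((C.Φ₁_le_of_concave hn hX hconc).trans_lt ?_)
    have hpos : 0 < ∑ l, C.margin l * C.X l C.share := by
      refine lt_of_le_of_ne (Finset.sum_nonneg fun l _ => mul_nonneg (C.margin_nonneg hn l)
        (C.X_nonneg l _ (C.share_mem_Icc hn))) fun h => ?_
      -- if all weights vanish, the average exponent is `0`
      rw [CityModel.averageExponent, ← h, div_zero] at havg
      exact absurd havg (by norm_num)
    rw [C.Φ₂_eq hn]
    rw [CityModel.averageExponent, one_lt_div hpos] at havg
    gcongr
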